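/- **Notation.** Let $q\in\mathbb C\setminus\{0\}$ be not a nontrivial root of unity (for instance a phase, $|q|=1$); $\lambda=q-q^{-1}$, $[n]_q=(q^n-q^{-n})/(q-q^{-1})$ (and $[n]_q=n$ for $q=1$), $[s]_q!=[s]_q\cdots[1]_q$, $1/\Gamma_q(p)=1/[p-1]_q!$ for $p\ge1$ and $1/\Gamma_q(p)=0$ for integers $p\le 0$. The momenta $k_v,k_-,k_+,k_{\bar v}$ generate the associative algebra with relations $$k_\pm k_v=q^{\pm1}k_vk_\pm,\quad k_\pm k_{\bar v}=q^{\pm1}k_{\bar v}k_\pm,\quad k_+k_--k_-k_+=\lambda k_vk_{\bar v},\quad k_{\bar v}k_v=k_vk_{\bar v},$$ and the q-cone relation $k_-k_+=q^{-1}k_vk_{\bar v}$. Fields are formal power series in the monomials $\bar v^{m}x_+^{\ell}x_-^{n}v^{j}$ (normally ordered in this order and treated as monomials in commuting variables) and in $z,\bar z$, with coefficients formal power series in the momenta; the momenta commute with $\bar v,x_\pm,v,z,\bar z$. For $\kappa\in\{\pm,v,\bar v,z,\bar z\}$ let $N_\kappa$ be the exponent of the variable $\kappa$ (of $x_\pm$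 for $\kappa=\pm$), $T_\kappa=q^{N_\kappa}$, $\hat M_\kappa$ the operator raising this exponent by one, and $\hat{\mathcal D}_\kappa=\hat M_\kappa^{-1}[N_\kappa]_q$. Put $$I^+=\tfrac12 q\bigl(\hat{\mathcal D}_v+\hat M_{\bar z}\hat{\mathcal D}_+T_-T_{\bar v}^{-1}T_v\bigr)T_v[2-N_z]_q-\tfrac12q^{3}\bigl(\hat{\mathcal D}_-+\hat M_{\bar z}\hat{\mathcal D}_{\bar v}T_-+\lambda q^{-1}\hat M_v\hat M_{\bar z}\hat{\mathcal D}_-\hat{\mathcal D}_+T_{\bar v}^{-1}T_-\bigr)\hat{\mathcal D}_zT_-T_v,$$ $$I^-=\tfrac12\Bigl(\bigl(\hat{\mathcal D}_{\bar v}T_{\bar v}T_-+\hat M_z\hat{\mathcal D}_+T_v+q^{-1}\lambda\hat M_v\hat{\mathcal D}_-\hat{\mathcal D}_+T_-\bigr)[2-N_{\bar z}]_q-q^{-2}\bigl(\hat{\mathcal D}_-+\hat M_z\hat{\mathcal D}_vT_-^{-1}\bigr)\hat{\mathcal D}_{\bar z}T_{\bar v}\Bigr)T_+T_{\bar z}T_z^{-1},$$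 $$\begin{aligned}I_{13}=\;&[N_z-1]_q\hat{\mathcal D}_{\bar z}T_{\bar z}\hat{\mathcal D}_vT_{\bar v}T_+T_-^{-1}+q\,\hat{\mathcal D}_{\bar z}T_{\bar z}\hat{\mathcal D}_z\hat{\mathcal D}_-T_{\bar v}T_+ +q[N_{\bar z}-1]_qT_{\bar z}[N_z-1]_q\hat{\mathcal D}_+T_+T_v\\&+q^2[N_{\bar z}-1]_q\hat{\mathcal D}_zT_{\bar z}\hat{\mathcal D}_{\bar v}T_{\bar v}T_-T_+ +\lambda q\,\hat M_v[N_{\bar z}-1]_q\hat{\mathcal D}_zT_{\bar z}\hat{\mathcal D}_-\hat{\mathcal D}_+T_-T_+ .\end{aligned}$$ Let $(\tilde\beta^s)^{-1}=\sum_{p=0}^sq^{(p-s)(p-1)+p}/([p]_q![s-p]_q!)$, assumed nonzero for all $s\ge 0$; let $\tilde d_s=\tilde\beta^{s-1}/\tilde\beta^{s}$ for $s\ge1$, $\tilde d_0$ arbitrary. For integer-valued $Q_s(a,b)$ let $$\tilde h_s^{Q}=\tilde\beta^s\sum_{a,b,n\ge0}\frac{(-1)^{s-a-b}\,q^{n(2a+2b-2n-s)+a(a-s-1)+b(s-a-b+1)+Q_s(a,b)}}{\Gamma_q(a-n+1)\Gamma_q(b-n+1)\Gamma_q(s-a-b+n+1)[n]_q!}\,k_{\bar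 v}^nk_+^{a-n}k_-^{b-n}k_v^{s-a-b+n}\;\bar v^{s-a-b+n}x_+^{b-n}x_-^{a-n}v^n ,$$ and write $\tilde h_s$ for $Q=0$ and $\tilde h'_s$ for $Q_s(a,b)=-2a$; thus $\tilde h'_s=T_-^{-2}T_v^{-2}\tilde h_s$. Put $\tilde h_{-1}=0$. **Current.** Let $\tilde\gamma^s_\kappa\in\mathbb C$ ($s\ge0$, $\kappa=\pm,v,\bar v$) be arbitrary, $\tilde K^s_m=\tilde\gamma^s_vk_v^{m+1}+\tilde\gamma^s_-k_-^{m+1}+\tilde\gamma^s_+k_+^{m+1}+\tilde\gamma^s_{\bar v}k_{\bar v}^{m+1}$, and $$\tilde J^{ms}_+=-q^{s+1}\tilde K^s_mk_-,\quad \tilde J^{ms}_-=-q^{-1}\tilde K^s_mk_+,\quad \tilde J^{ms}_v=\tilde K^s_mk_{\bar v},\quad \tilde J^{ms}_{\bar v}=q^s\tilde K^s_mk_v,$$ $$J=\bar zz\tilde J_++z\tilde J_v+\bar z\tilde J_{\bar v}+\tilde J_-,\qquad \tilde J_\kappa=\sum_{m,s\ge0}\frac1{[s]_q!}\tilde J^{ms}_\kappa\,\tilde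 h_{s-1}.$$ **Fields.** Let $\tilde F^+=\sum_{m,s\ge0}\frac1{[s]_q!}\tilde F^+_{ms}\tilde h'_s$ and $\tilde F^-=\sum_{m,s\ge0}\frac1{[s]_q!}\tilde F^-_{ms}\tilde h_s$ with $$\tilde F^+_{ms}=2\tilde d_sq^{s-2}\bigl((\tilde\gamma^s_-k_-^m+q^{-1}z\tilde\gamma^s_vk_v^m)(k_v-qzk_-)+(\tilde\gamma^s_{\bar v}k_{\bar v}^m+q^{-1}z\tilde\gamma^s_+k_+^m)(k_+-qzk_{\bar v})\bigr),$$ $$\tilde F^-_{ms}=2\tilde d_s\bigl((q^{-s-3}\tilde\gamma^s_-k_-^m+q\bar z\tilde\gamma^s_{\bar v}k_{\bar v}^m)(k_{\bar v}-q^{s+2}\bar zk_-)+(q^{-s-3}\tilde\gamma^s_vk_v^m+q\bar z\tilde\gamma^s_+k_+^m)(k_+-q^{s+2}\bar zk_v)\bigr),$$ and let $\tilde F^{h\pm}=\sum_{m,s\ge0}\frac1{[s]_q!}\tilde F^{h\pm}_{ms}\tilde h_s$ with, for arbitrary constants $\tilde p,\tilde r$, $$\begin{aligned}\tilde F^{h+}_{ms}=\sum_{i=0}^m\Bigl(&\sum_{j=0}^{m-i}\tilde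 p^{ms1}_{ij}k_{\bar v}^ik_-^{m-i-j}k_v^j(k_v-zk_-)(k_v-qzk_-)+\tilde p^{ms2}_ik_{\bar v}^ik_v^{m-i}(k_+-zk_{\bar v})(k_v-qzk_-)\\&+\sum_{j=0}^{m-i}\tilde p^{ms3}_{ij}k_{\bar v}^ik_+^{m-i-j}k_v^j(k_+-zk_{\bar v})(k_+-qzk_{\bar v})\Bigr),\end{aligned}$$ $$\begin{aligned}\tilde F^{h-}_{ms}=\sum_{i=0}^m\Bigl(&\sum_{j=0}^{m-i}\tilde r^{ms1}_{ij}k_{\bar v}^ik_-^{m-i-j}k_v^j(k_{\bar v}-q^{s+5}\bar zk_-)(k_{\bar v}-q^{s+2}\bar zk_-)+\tilde r^{ms2}_ik_v^ik_{\bar v}^{m-i}(k_{\bar v}-q^{s+5}\bar zk_-)(k_+-q^{s+2}\bar zk_v)\\&+\sum_{j=0}^{m-i}\tilde r^{ms3}_{ij}k_v^ik_+^{m-i-j}k_{\bar v}^j(k_+-q^{s+5}\bar zk_v)(k_+-q^{s+2}\bar zk_v)\Bigr).\end{aligned}$$ **Theorem.** All these series are well-defined formal power series (each coefficient is a finite sum),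 and: 1. $I^\pm\tilde F^{h\pm}=0$, and the full q-Maxwell equations $I^+(\tilde F^++\tilde F^{h+})=J$ and $I^-(\tilde F^-+\tilde F^{h-})=J$ hold. 2. The current is q-conserved: $I_{13}J=0$. More generally, if $C^{ms}_\kappa$ are any elements of the momentum algebra with $$C^{ms}_+k_++q^sC^{ms}_vk_v+C^{ms}_{\bar v}k_{\bar v}+q^sC^{ms}_-k_-=0\qquad(m,s\ge0),\tag{$*$}$$ then $I_{13}$ annihilates the current built from $C^{ms}_\kappa$ in place of $\tilde J^{ms}_\kappa$ (the coefficients being marked as of degree $m+2$ in the momenta). 3. For all $m,s\ge0$ the $\tilde J^{ms}_\kappa$ satisfy $(*)$ and, writing $J_\kappa=\tilde J^{ms}_\kappa$, also its splittings $$J_+k_++q^sJ_vk_v=0,\quad J_{\bar v}k_{\bar v}+q^sJ_-k_-=0,\quad J_+k_++J_{\bar v}k_{\bar v}=0,\quad J_vk_v+J_-k_-=0,$$ and the relations $$J_+k_{\bar v}+q^sJ_vk_-=0,\quad J_{\bar v}k_++q^sJ_-k_v=0,\quad J_+k_v+J_{\bar v}k_-=0,\quad J_vk_++J_-k_{\bar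 v}=0.$$ -/

import Mathlib

noncomputable section

namespace QMaxwell

open MvPowerSeries

/-! ### q-numbers -/

/-- The q-number `[n]_q = (q^n - q^{-n}) / (q - q^{-1})`, with its limit value `n` at `q = 1`. -/
def qInt (q : ℂ) (n : ℤ) : ℂ :=
  if q = 1 then (n : ℂ) else (q ^ n - q ^ (-n)) / (q - q⁻¹)

/-- The q-factorial `[s]_q! = [s]_q [s-1]_q ⋯ [1]_q`. -/
def qFact (q : ℂ) (s : ℕ) : ℂ := ∏ i ∈ Finset.range s, qInt q (i + 1)

/-- `1 / Γ_q(p)`: it is `1 / [p-1]_q!` for `p ≥ 1` and `0` for integers `p ≤ 0`. -/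
def invGammaQ (q : ℂ) (p : ℤ) : ℂ := if p ≤ 0 then 0 else (qFact q (p - 1).toNat)⁻¹

/-- `λ = q - q^{-1}`. -/
def lam (q : ℂ) : ℂ := q - q⁻¹

/-! ### The noncommutative momenta on the q-cone -/

/-- Labels `v, -, +, v̄` of the momentum components. -/
inductive Mom
  | v
  | m
  | p
  | vb

/-- Commutation relations of the momenta `k_v, k_-, k_+, k_v̄` (those of q-Minkowski space-time),
together with the q-cone relation `k_- k_+ = q^{-1} k_v k_v̄`. -/
inductive MomRel (q : ℂ) : FreeAlgebra ℂ Mom → FreeAlgebra ℂ Mom → Prop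
  | p_v : MomRel q (FreeAlgebra.ι ℂ Mom.p * FreeAlgebra.ι ℂ Mom.v)
      (q • (FreeAlgebra.ι ℂ Mom.v * FreeAlgebra.ι ℂ Mom.p))
  | m_v : MomRel q (FreeAlgebra.ι ℂ Mom.m * FreeAlgebra.ι ℂ Mom.v)
      (q⁻¹ • (FreeAlgebra.ι ℂ Mom.v * FreeAlgebra.ι ℂ Mom.m))
  | p_vb : MomRel q (FreeAlgebra.ι ℂ Mom.p * FreeAlgebra.ι ℂ Mom.vb)
      (q • (FreeAlgebra.ι ℂ Mom.vb * FreeAlgebra.ι ℂ Mom.p))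
  | m_vb : MomRel q (FreeAlgebra.ι ℂ Mom.m * FreeAlgebra.ι ℂ Mom.vb)
      (q⁻¹ • (FreeAlgebra.ι ℂ Mom.vb * FreeAlgebra.ι ℂ Mom.m))
  | p_m : MomRel q
      (FreeAlgebra.ι ℂ Mom.p * FreeAlgebra.ι ℂ Mom.m -
        FreeAlgebra.ι ℂ Mom.m * FreeAlgebra.ι ℂ Mom.p)
      (lam q • (FreeAlgebra.ι ℂ Mom.v * FreeAlgebra.ι ℂ Mom.vb))
  | vb_v : MomRel q (FreeAlgebra.ι ℂ Mom.vb * FreeAlgebra.ι ℂ Mom.v)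
      (FreeAlgebra.ι ℂ Mom.v * FreeAlgebra.ι ℂ Mom.vb)
  | cone : MomRel q (FreeAlgebra.ι ℂ Mom.m * FreeAlgebra.ι ℂ Mom.p)
      (q⁻¹ • (FreeAlgebra.ι ℂ Mom.v * FreeAlgebra.ι ℂ Mom.vb))

/-- The algebra of momenta on the q-cone. -/
def MomAlg (q : ℂ) : Type := RingQuot (MomRel q)

instance instRingMomAlg (q : ℂ) : Ring (MomAlg q) :=
  inferInstanceAs (Ring (RingQuot (MomRel q)))

instance instAlgebraMomAlg (q : ℂ) : Algebra ℂ (MomAlg q) :=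
  inferInstanceAs (Algebra ℂ (RingQuot (MomRel q)))

/-- The momentum component `k_κ`. -/
def k (q : ℂ) (κ : Mom) : MomAlg q :=
  RingQuot.mkAlgHom ℂ (MomRel q) (FreeAlgebra.ι ℂ κ)

/-! ### Fields: formal power series

A field is a formal power series in the (commuting) variables `v̄, x_+, x_-, v` and `z, z̄` with
coefficients in the algebra of momenta, the momenta commuting with the variables. The monomial
`v̄^m x_+^l x_-^n v^j` stands for the normally ordered monomial, in this order, of the conjugate
basis. The further central variable `t` only marks the total degree in the momenta (each `k_κ`
enters multiplied by `t`), so that a series that is infinite in the momenta is a formal power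
series too. -/

/-- The variables. -/
inductive Var
  | t
  | vb
  | xp
  | xm
  | v
  | z
  | zb
  deriving DecidableEq

/-- The space of fields. -/
abbrev Fld (q : ℂ) : Type := MvPowerSeries Var (MomAlg q)

/-- The element `a` of the algebra of momenta, marked as having degree `d`. -/
def momElt (q : ℂ) (d : ℕ) (a : MomAlg q) : Fld q := monomial (Finsupp.single Var.t d) a

/-- The momentum component `k_κ`, as a (constant) field. -/
def kk (q : ℂ) (κ : Mom) : Fld q := momElt q 1 (k q κ)

/-- A variable, as a field. -/
def x (q : ℂ) (i : Var) : Fld q := X i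

/-! ### Operators on fields -/

/-- The operator that multiplies the monomial with exponent vector `n` by the number `f n`. -/
def diagOp (q : ℂ) (f : (Var →₀ ℕ) → ℂ) : Module.End ℂ (Fld q) where
  toFun φ := fun n => f n • coeff n φ
  map_add' φ ψ := by
    funext n
    change f n • (coeff n (φ + ψ)) = f n • coeff n φ + f n • coeff n ψ
    rw [map_add, smul_add]
  map_smul' c φ := by
    funext n
    change f n • (c • coeff n φ) = c • (f n • coeff n φ)
    rw [smul_comm]

/-- `M̂_i^{-1}`: lowers the exponent of the variable `i` by one (monomials free of `i` go to 0). -/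
def lowerOp (q : ℂ) (i : Var) : Module.End ℂ (Fld q) where
  toFun φ := fun n => coeff (n + Finsupp.single i 1) φ
  map_add' φ ψ := by
    funext n
    change coeff (n + Finsupp.single i 1) (φ + ψ) = coeff _ φ + coeff _ ψ
    rw [map_add]
  map_smul' _ _ := rfl

/-- `M̂_i`: raises the exponent of the variable `i` by one. -/
def M (q : ℂ) (i : Var) : Module.End ℂ (Fld q) := LinearMap.mulLeft ℂ (x q i)

/-- `T_i^e = q^{e N_i}`, where `N_i` is the exponent of the variable `i`. -/
def T (q : ℂ) (i : Var) (e : ℤ) : Module.End ℂ (Fld q) := diagOp q fun n => q ^ (e * (n i : ℤ))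

/-- `[c + e N_i]_q`. -/
def brN (q : ℂ) (c e : ℤ) (i : Var) : Module.End ℂ (Fld q) :=
  diagOp q fun n => qInt q (c + e * (n i : ℤ))

/-- The q-difference operator `D̂_i = λ^{-1} M̂_i^{-1} (T_i - T_i^{-1}) = M̂_i^{-1} [N_i]_q`. -/
def D (q : ℂ) (i : Var) : Module.End ℂ (Fld q) := lowerOp q i * brN q 0 1 i

/-- The q-Maxwell operator `_qI_n^+` in the conjugate basis. -/
def Iplus (q : ℂ) (n : ℤ) : Module.End ℂ (Fld q) :=
  (1 / 2 : ℂ) • (q • ((D q .v + M q .zb * D q .xp * T q .xm 1 * T q .vb (-1) * T q .v 1)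
      * T q .v 1 * brN q (n + 2) (-1) .z))
  - (1 / 2 : ℂ) • (q ^ (n + 3) • ((D q .xm + M q .zb * D q .vb * T q .xm 1
      + (lam q * q⁻¹) • (M q .v * M q .zb * D q .xm * D q .xp * T q .vb (-1) * T q .xm 1))
      * D q .z * T q .xm 1 * T q .v 1))

/-- The q-Maxwell operator `_qI_n^-` in the conjugate basis. -/
def Iminus (q : ℂ) (n : ℤ) : Module.End ℂ (Fld q) :=
  (1 / 2 : ℂ) • (((D q .vb * T q .vb 1 * T q .xm 1 + M q .z * D q .xp * T q .v 1
      + (q⁻¹ * lam q) • (M q .v * D q .xm * D q .xp * T q .xm 1)) * brN q (n + 2) (-1) .zb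
    - q ^ (-n - 2) • ((D q .xm + M q .z * D q .v * T q .xm (-1)) * D q .zb * T q .vb 1))
      * T q .xp 1 * T q .zb 1 * T q .z (-1))

/-- The operator `I_13` of q-current conservation in the conjugate basis. -/
def I13 (q : ℂ) : Module.End ℂ (Fld q) :=
  brN q (-1) 1 .z * D q .zb * T q .zb 1 * D q .v * T q .vb 1 * T q .xp 1 * T q .xm (-1)
  + q • (D q .zb * T q .zb 1 * D q .z * D q .xm * T q .vb 1 * T q .xp 1)
  + q • (brN q (-1) 1 .zb * T q .zb 1 * brN q (-1) 1 .z * D q .xp * T q .xp 1 * T q .v 1)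
  + q ^ 2 • (brN q (-1) 1 .zb * D q .z * T q .zb 1 * D q .vb * T q .vb 1 * T q .xm 1 * T q .xp 1)
  + (lam q * q) • (M q .v * brN q (-1) 1 .zb * D q .z * T q .zb 1 * D q .xm * D q .xp
      * T q .xm 1 * T q .xp 1)

/-! ### Infinite sums of fields -/

/-- Every coefficient receives only finitely many contributions. -/
def FormallySummable {q : ℂ} (f : ℕ → ℕ → Fld q) : Prop :=
  ∀ n : Var →₀ ℕ, {p : ℕ × ℕ | coeff n (f p.1 p.2) ≠ 0}.Finite

/-- The coefficientwise sum `∑_{m,s ≥ 0} f m s` of a formally summable family. -/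
def formalSum {q : ℂ} (f : ℕ → ℕ → Fld q) : Fld q :=
  fun n => ∑ᶠ p : ℕ × ℕ, coeff n (f p.1 p.2)

/-! ### The components of the q-plane wave in the conjugate basis -/

/-- `(β̃^s)^{-1} = ∑_{p=0}^s q^{(p-s)(p-1)+p} / ([p]_q! [s-p]_q!)`. -/
def betaInv (q : ℂ) (s : ℕ) : ℂ :=
  ∑ p ∈ Finset.range (s + 1),
    q ^ (((p : ℤ) - s) * ((p : ℤ) - 1) + p) / (qFact q p * qFact q (s - p))

/-- `β̃^s`. -/
def beta (q : ℂ) (s : ℕ) : ℂ := (betaInv q s)⁻¹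

/-- The component `h̃_s`, for the given exponents `Q_s(a,b)`. The terms with `n > a`, `n > b` or
`a + b > s + n` vanish because of the factors `1 / Γ_q`; all others have `a, b, n ≤ s`. -/
def th (q : ℂ) (Q : ℕ → ℕ → ℕ → ℤ) (s : ℕ) : Fld q :=
  beta q s • ∑ a ∈ Finset.range (s + 1), ∑ b ∈ Finset.range (s + 1), ∑ n ∈ Finset.range (s + 1),
    ((-1 : ℂ) ^ ((s : ℤ) - a - b)
      * q ^ ((n : ℤ) * (2 * a + 2 * b - 2 * n - s) + (a : ℤ) * ((a : ℤ) - s - 1)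
          + (b : ℤ) * ((s : ℤ) - a - b + 1))
      * q ^ Q s a b
      * invGammaQ q ((a : ℤ) - n + 1) * invGammaQ q ((b : ℤ) - n + 1)
      * invGammaQ q ((s : ℤ) - a - b + n + 1) * (qFact q n)⁻¹) •
    (kk q .vb ^ n * kk q .p ^ (a - n) * kk q .m ^ (b - n) * kk q .v ^ (s + n - a - b)
      * (x q .vb ^ (s + n - a - b) * x q .xp ^ (b - n) * x q .xm ^ (a - n) * x q .v ^ n))

/-- `h̃_s` with `Q_s(a,b) = 0`. -/
def th0 (q : ℂ) (s : ℕ) : Fld q := th q (fun _ _ _ => 0) s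

/-- `h̃_s` with `Q_s(a,b) = -2a`. -/
def thA (q : ℂ) (s : ℕ) : Fld q := th q (fun _ a _ => -2 * (a : ℤ)) s

/-- `h̃_{s-1}` with `Q = 0`, where `h̃_{-1} = 0`. -/
def thPrev (q : ℂ) : ℕ → Fld q
  | 0 => 0
  | s + 1 => th0 q s

/-- `d̃_s = β̃^{s-1} / β̃^s` for `s ≥ 1`; the value `d₀` at `s = 0` is free. -/
def dt (q d₀ : ℂ) : ℕ → ℂ
  | 0 => d₀
  | s + 1 => beta q s / beta q (s + 1)

/-! ### The current -/

/-- `K̃^s_m(k)`. -/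
def Kt (q : ℂ) (γ : ℕ → Mom → ℂ) (m s : ℕ) : MomAlg q :=
  γ s .v • k q .v ^ (m + 1) + γ s .m • k q .m ^ (m + 1)
    + γ s .p • k q .p ^ (m + 1) + γ s .vb • k q .vb ^ (m + 1)

/-- `J̃^{ms}_κ(k)`. -/
def Jt (q : ℂ) (γ : ℕ → Mom → ℂ) (m s : ℕ) : Mom → MomAlg q
  | .p => -(q ^ (s + 1) • (Kt q γ m s * k q .m))
  | .m => -(q⁻¹ • (Kt q γ m s * k q .p))
  | .v => Kt q γ m s * k q .vb
  | .vb => q ^ s • (Kt q γ m s * k q .v)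

/-- The `(m,s)`-term of the component `J_κ` of the current with coefficients `C^{ms}_κ(k)`
(of degree `m + 2` in the momenta). -/
def currentTerm (q : ℂ) (C : ℕ → ℕ → Mom → MomAlg q) (κ : Mom) (m s : ℕ) : Fld q :=
  (qFact q s)⁻¹ • (momElt q (m + 2) (C m s κ) * thPrev q s)

/-- `J = z̄ z J_+ + z J_v + z̄ J_v̄ + J_-` with
`J_κ = ∑_{m,s} (1/[s]_q!) C^{ms}_κ(k) h̃_{s-1}`. -/
def current (q : ℂ) (C : ℕ → ℕ → Mom → MomAlg q) : Fld q :=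
  x q .zb * x q .z * formalSum (currentTerm q C .p) + x q .z * formalSum (currentTerm q C .v)
    + x q .zb * formalSum (currentTerm q C .vb) + formalSum (currentTerm q C .m)

/-- The q-current-conservation law
`J^s_+ k_+ + q^s J^s_v k_v + J^s_v̄ k_v̄ + q^s J^s_- k_- = 0` in momentum space. -/
def MomConservation (q : ℂ) (s : ℕ) (J : Mom → MomAlg q) : Prop :=
  J .p * k q .p + q ^ s • (J .v * k q .v) + J .vb * k q .vb + q ^ s • (J .m * k q .m) = 0

/-! ### The fields -/

/-- `F̃^+_{ms}(k)`. -/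
def FtPlus (q d₀ : ℂ) (γ : ℕ → Mom → ℂ) (m s : ℕ) : Fld q :=
  (2 * dt q d₀ s * q ^ ((s : ℤ) - 2)) •
    ((γ s .m • kk q .m ^ m + (q⁻¹ * γ s .v) • (x q .z * kk q .v ^ m))
        * (kk q .v - q • (x q .z * kk q .m))
      + (γ s .vb • kk q .vb ^ m + (q⁻¹ * γ s .p) • (x q .z * kk q .p ^ m))
        * (kk q .p - q • (x q .z * kk q .vb)))

/-- `F̃^-_{ms}(k)`. -/
def FtMinus (q d₀ : ℂ) (γ : ℕ → Mom → ℂ) (m s : ℕ) : Fld q :=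
  (2 * dt q d₀ s) •
    (((q ^ (-(s : ℤ) - 3) * γ s .m) • kk q .m ^ m + (q * γ s .vb) • (x q .zb * kk q .vb ^ m))
        * (kk q .vb - q ^ (s + 2) • (x q .zb * kk q .m))
      + ((q ^ (-(s : ℤ) - 3) * γ s .v) • kk q .v ^ m + (q * γ s .p) • (x q .zb * kk q .p ^ m))
        * (kk q .p - q ^ (s + 2) • (x q .zb * kk q .v)))

/-- `F̃^{h+}_{ms}(k)`. -/
def FhPlus (q : ℂ) (p₁ : ℕ → ℕ → ℕ → ℕ → ℂ) (p₂ : ℕ → ℕ → ℕ → ℂ) (p₃ : ℕ → ℕ → ℕ → ℕ → ℂ)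
    (m s : ℕ) : Fld q :=
  ∑ i ∈ Finset.range (m + 1),
    ((∑ j ∈ Finset.range (m - i + 1), p₁ m s i j •
        (kk q .vb ^ i * kk q .m ^ (m - i - j) * kk q .v ^ j
          * (kk q .v - x q .z * kk q .m) * (kk q .v - q • (x q .z * kk q .m))))
      + p₂ m s i • (kk q .vb ^ i * kk q .v ^ (m - i)
          * (kk q .p - x q .z * kk q .vb) * (kk q .v - q • (x q .z * kk q .m)))
      + ∑ j ∈ Finset.range (m - i + 1), p₃ m s i j •
        (kk q .vb ^ i * kk q .p ^ (m - i - j) * kk q .v ^ j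
          * (kk q .p - x q .z * kk q .vb) * (kk q .p - q • (x q .z * kk q .vb))))

/-- `F̃^{h-}_{ms}(k)`. -/
def FhMinus (q : ℂ) (r₁ : ℕ → ℕ → ℕ → ℕ → ℂ) (r₂ : ℕ → ℕ → ℕ → ℂ) (r₃ : ℕ → ℕ → ℕ → ℕ → ℂ)
    (m s : ℕ) : Fld q :=
  ∑ i ∈ Finset.range (m + 1),
    ((∑ j ∈ Finset.range (m - i + 1), r₁ m s i j •
        (kk q .vb ^ i * kk q .m ^ (m - i - j) * kk q .v ^ j
          * (kk q .vb - q ^ (s + 5) • (x q .zb * kk q .m))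
          * (kk q .vb - q ^ (s + 2) • (x q .zb * kk q .m))))
      + r₂ m s i • (kk q .v ^ i * kk q .vb ^ (m - i)
          * (kk q .vb - q ^ (s + 5) • (x q .zb * kk q .m))
          * (kk q .p - q ^ (s + 2) • (x q .zb * kk q .v)))
      + ∑ j ∈ Finset.range (m - i + 1), r₃ m s i j •
        (kk q .v ^ i * kk q .p ^ (m - i - j) * kk q .vb ^ j
          * (kk q .p - q ^ (s + 5) • (x q .zb * kk q .v))
          * (kk q .p - q ^ (s + 2) • (x q .zb * kk q .v))))

/-- The family `(1/[s]_q!) G_{ms}(k) h_s`. -/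
def waveTerm (q : ℂ) (G : ℕ → ℕ → Fld q) (h : ℕ → Fld q) (m s : ℕ) : Fld q :=
  (qFact q s)⁻¹ • (G m s * h s)

/-- The field `∑_{m,s} (1/[s]_q!) G_{ms}(k) h_s`. -/
def wave (q : ℂ) (G : ℕ → ℕ → Fld q) (h : ℕ → Fld q) : Fld q := formalSum (waveTerm q G h)

end QMaxwell

end

open QMaxwell

noncomputable section

namespace QMaxwell

open MvPowerSeries

variable {q : ℂ}

/-! ### Homogeneous slices of fields -/

/-- The field of degree `d` in the momenta, `a` in `z` and `b` in `z̄`, whose coefficient at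
`v̄^l x_+^p x_-^m v^n` is `f l p m n`. -/
def slice (q : ℂ) (d a b : ℕ) (f : ℕ → ℕ → ℕ → ℕ → MomAlg q) : Fld q := fun e =>
  if e .t = d ∧ e .z = a ∧ e .zb = b then f (e .vb) (e .xp) (e .xm) (e .v) else 0

variable {d a b : ℕ} {f g : ℕ → ℕ → ℕ → ℕ → MomAlg q}

theorem coeff_slice (e : Var →₀ ℕ) : coeff e (slice q d a b f) =
    if e .t = d ∧ e .z = a ∧ e .zb = b then f (e .vb) (e .xp) (e .xm) (e .v) else 0 := rfl

theorem coeff_diagOp (c : (Var →₀ ℕ) → ℂ) (e : Var →₀ ℕ) (φ : Fld q) :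
    coeff e (diagOp q c φ) = c e • coeff e φ := rfl

theorem coeff_lowerOp (i : Var) (e : Var →₀ ℕ) (φ : Fld q) :
    coeff e (lowerOp q i φ) = coeff (e + Finsupp.single i 1) φ := rfl

theorem coeff_smul' (c : ℂ) (e : Var →₀ ℕ) (φ : Fld q) :
    coeff e (c • φ) = c • coeff e φ := rfl

theorem coeff_x_mul (i : Var) (e : Var →₀ ℕ) (φ : Fld q) :
    coeff e (x q i * φ) = if e i = 0 then 0 else coeff (e - Finsupp.single i 1) φ := by
  rw [x, X_def, coeff_monomial_mul, one_mul]
  by_cases h : e i = 0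
  · rw [if_neg, if_pos h]
    intro hle
    have := hle i
    simp [h] at this
  · rw [if_pos, if_neg h]
    rw [Finsupp.single_le_iff]
    omega

theorem coeff_momElt_mul (c : ℕ) (A : MomAlg q) (e : Var →₀ ℕ) (φ : Fld q) :
    coeff e (momElt q c A * φ)
      = if c ≤ e .t then A * coeff (e - Finsupp.single .t c) φ else 0 := by
  rw [momElt, coeff_monomial_mul]
  simp only [Finsupp.single_le_iff]

theorem slice_add : slice q d a b (fun l p m n => f l p m n + g l p m n)
    = slice q d a b f + slice q d a b g := by
  ext e
  rw [map_add]
  simp only [coeff_slice]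
  split_ifs <;> simp

theorem slice_smul (c : ℂ) : slice q d a b (fun l p m n => c • f l p m n)
    = c • slice q d a b f := by
  ext e
  rw [coeff_smul']
  simp only [coeff_slice]
  split_ifs <;> simp

theorem slice_zero : slice q d a b (fun _ _ _ _ => 0) = 0 := by
  ext e
  simp only [coeff_slice]
  split_ifs <;> simp

theorem momElt_mul_slice (c : ℕ) (A : MomAlg q) :
    momElt q c A * slice q d a b f = slice q (d + c) a b (fun l p m n => A * f l p m n) := by
  ext e
  rw [coeff_momElt_mul]
  simp only [coeff_slice, Finsupp.coe_tsub, Pi.sub_apply, Finsupp.single_apply, reduceCtorEq,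
    if_true, if_false, tsub_zero]
  by_cases h : c ≤ e .t
  · have : e .t - c = d ↔ e .t = d + c := by omega
    simp only [this, if_pos h]
    split_ifs <;> simp
  · have : ¬ e .t = d + c := by omega
    simp [this, h]

theorem kk_mul_slice (κ : Mom) :
    kk q κ * slice q d a b f = slice q (d + 1) a b (fun l p m n => k q κ * f l p m n) :=
  momElt_mul_slice 1 _

@[simp]
theorem x_z_mul_slice : x q .z * slice q d a b f = slice q d (a + 1) b f := by
  ext e
  rw [coeff_x_mul]
  simp only [coeff_slice, Finsupp.coe_tsub, Pi.sub_apply, Finsupp.single_apply, reduceCtorEq,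
    if_true, if_false, tsub_zero]
  by_cases h : e .z = 0
  · simp [h]
  · have : e .z - 1 = a ↔ e .z = a + 1 := by omega
    simp [h, this]

@[simp]
theorem x_zb_mul_slice : x q .zb * slice q d a b f = slice q d a (b + 1) f := by
  ext e
  rw [coeff_x_mul]
  simp only [coeff_slice, Finsupp.coe_tsub, Pi.sub_apply, Finsupp.single_apply, reduceCtorEq,
    if_true, if_false, tsub_zero]
  by_cases h : e .zb = 0
  · simp [h]
  · have : e .zb - 1 = b ↔ e .zb = b + 1 := by omega
    simp [h, this]

@[simp]
theorem x_v_mul_slice : x q .v * slice q d a b f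
    = slice q d a b (fun l p m n => if n = 0 then 0 else f l p m (n - 1)) := by
  ext e
  rw [coeff_x_mul]
  simp only [coeff_slice, Finsupp.coe_tsub, Pi.sub_apply, Finsupp.single_apply, reduceCtorEq,
    if_true, if_false, tsub_zero]
  by_cases h : e .v = 0 <;> simp [h]

@[simp]
theorem M_apply (i : Var) (φ : Fld q) : M q i φ = x q i * φ := rfl

@[simp]
theorem T_vb_slice (c : ℤ) : T q .vb c (slice q d a b f)
    = slice q d a b (fun l p m n => q ^ (c * (l : ℤ)) • f l p m n) := by
  ext e
  rw [T, coeff_diagOp, coeff_slice, coeff_slice, smul_ite, smul_zero]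

@[simp]
theorem T_xp_slice (c : ℤ) : T q .xp c (slice q d a b f)
    = slice q d a b (fun l p m n => q ^ (c * (p : ℤ)) • f l p m n) := by
  ext e
  rw [T, coeff_diagOp, coeff_slice, coeff_slice, smul_ite, smul_zero]

@[simp]
theorem T_xm_slice (c : ℤ) : T q .xm c (slice q d a b f)
    = slice q d a b (fun l p m n => q ^ (c * (m : ℤ)) • f l p m n) := by
  ext e
  rw [T, coeff_diagOp, coeff_slice, coeff_slice, smul_ite, smul_zero]

@[simp]
theorem T_v_slice (c : ℤ) : T q .v c (slice q d a b f)
    = slice q d a b (fun l p m n => q ^ (c * (n : ℤ)) • f l p m n) := by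
  ext e
  rw [T, coeff_diagOp, coeff_slice, coeff_slice, smul_ite, smul_zero]

@[simp]
theorem T_z_slice (c : ℤ) : T q .z c (slice q d a b f) = q ^ (c * (a : ℤ)) • slice q d a b f := by
  ext e
  rw [T, coeff_diagOp, coeff_smul', coeff_slice]
  split_ifs with h
  · rw [h.2.1]
  · rw [smul_zero, smul_zero]

@[simp]
theorem T_zb_slice (c : ℤ) :
    T q .zb c (slice q d a b f) = q ^ (c * (b : ℤ)) • slice q d a b f := by
  ext e
  rw [T, coeff_diagOp, coeff_smul', coeff_slice]
  split_ifs with h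
  · rw [h.2.2]
  · rw [smul_zero, smul_zero]

@[simp]
theorem brN_z_slice (c e : ℤ) :
    brN q c e .z (slice q d a b f) = qInt q (c + e * a) • slice q d a b f := by
  ext e
  rw [brN, coeff_diagOp, coeff_smul', coeff_slice]
  split_ifs with h
  · rw [h.2.1]
  · rw [smul_zero, smul_zero]

@[simp]
theorem brN_zb_slice (c e : ℤ) :
    brN q c e .zb (slice q d a b f) = qInt q (c + e * b) • slice q d a b f := by
  ext e
  rw [brN, coeff_diagOp, coeff_smul', coeff_slice]
  split_ifs with h
  · rw [h.2.2]
  · rw [smul_zero, smul_zero]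

theorem coeff_D (i : Var) (e : Var →₀ ℕ) (φ : Fld q) : coeff e (D q i φ)
    = qInt q ((e i : ℤ) + 1) • coeff (e + Finsupp.single i 1) φ := by
  rw [D, Module.End.mul_apply, coeff_lowerOp, brN, coeff_diagOp]
  simp

@[simp]
theorem D_vb_slice : D q .vb (slice q d a b f)
    = slice q d a b (fun l p m n => qInt q ((l : ℤ) + 1) • f (l + 1) p m n) := by
  ext e
  rw [coeff_D, coeff_slice, coeff_slice, smul_ite, smul_zero]
  simp

@[simp]
theorem D_xp_slice : D q .xp (slice q d a b f)
    = slice q d a b (fun l p m n => qInt q ((p : ℤ) + 1) • f l (p + 1) m n) := by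
  ext e
  rw [coeff_D, coeff_slice, coeff_slice, smul_ite, smul_zero]
  simp

@[simp]
theorem D_xm_slice : D q .xm (slice q d a b f)
    = slice q d a b (fun l p m n => qInt q ((m : ℤ) + 1) • f l p (m + 1) n) := by
  ext e
  rw [coeff_D, coeff_slice, coeff_slice, smul_ite, smul_zero]
  simp

@[simp]
theorem D_v_slice : D q .v (slice q d a b f)
    = slice q d a b (fun l p m n => qInt q ((n : ℤ) + 1) • f l p m (n + 1)) := by
  ext e
  rw [coeff_D, coeff_slice, coeff_slice, smul_ite, smul_zero]
  simp

@[simp]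
theorem D_z_slice_zero : D q .z (slice q d 0 b f) = 0 := by
  ext e
  rw [coeff_D, coeff_slice]
  simp

@[simp]
theorem D_z_slice_succ :
    D q .z (slice q d (a + 1) b f) = qInt q (a + 1) • slice q d a b f := by
  ext e
  rw [coeff_D, coeff_smul', coeff_slice, coeff_slice]
  simp only [Finsupp.coe_add, Pi.add_apply, Finsupp.single_apply, reduceCtorEq, if_true, if_false,
    add_zero, add_left_inj]
  split_ifs with h
  · rw [h.2.1]
  · rw [smul_zero, smul_zero]

@[simp]
theorem D_zb_slice_zero : D q .zb (slice q d a 0 f) = 0 := by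
  ext e
  rw [coeff_D, coeff_slice]
  simp

@[simp]
theorem D_zb_slice_succ :
    D q .zb (slice q d a (b + 1) f) = qInt q (b + 1) • slice q d a b f := by
  ext e
  rw [coeff_D, coeff_smul', coeff_slice, coeff_slice]
  simp only [Finsupp.coe_add, Pi.add_apply, Finsupp.single_apply, reduceCtorEq, if_true, if_false,
    add_zero, add_left_inj]
  split_ifs with h
  · rw [h.2.2]
  · rw [smul_zero, smul_zero]

/-! ### The spin-free parts of the operators -/

/-- The part of `I^+` without `z̄` and `z`-derivative. -/
def P₁ (q : ℂ) : Module.End ℂ (Fld q) := D q .v * T q .v 1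

/-- The part of `I^+` with `z̄` and without `z`-derivative. -/
def P₂ (q : ℂ) : Module.End ℂ (Fld q) := D q .xp * T q .xm 1 * T q .vb (-1) * T q .v 1 * T q .v 1

/-- The part of `I^+` without `z̄` and with a `z`-derivative. -/
def P₃ (q : ℂ) : Module.End ℂ (Fld q) := D q .xm * T q .xm 1 * T q .v 1

/-- The part of `I^+` with `z̄` and a `z`-derivative. -/
def P₄ (q : ℂ) : Module.End ℂ (Fld q) :=
  (D q .vb * T q .xm 1
    + (lam q * q⁻¹) • (M q .v * D q .xm * D q .xp * T q .vb (-1) * T q .xm 1))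
  * T q .xm 1 * T q .v 1

/-- The part of `I^-` and `I_13` that contains `D_-`. -/
def R₁ (q : ℂ) : Module.End ℂ (Fld q) := D q .xm * T q .vb 1 * T q .xp 1

/-- The part of `I^-` and `I_13` that contains `D_v̄`. -/
def R₂ (q : ℂ) : Module.End ℂ (Fld q) :=
  (D q .vb * T q .vb 1 * T q .xm 1 + (q⁻¹ * lam q) • (M q .v * D q .xm * D q .xp * T q .xm 1))
  * T q .xp 1

/-- The part of `I^-` and `I_13` that contains `D_v`. -/
def R₃ (q : ℂ) : Module.End ℂ (Fld q) := D q .v * T q .xm (-1) * T q .vb 1 * T q .xp 1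

/-- The part of `I^-` and `I_13` that contains `D_+`. -/
def R₄ (q : ℂ) : Module.End ℂ (Fld q) := D q .xp * T q .v 1 * T q .xp 1

theorem qInt_zero : qInt q 0 = 0 := by simp [qInt]

theorem qInt_neg (n : ℤ) : qInt q (-n) = -qInt q n := by
  unfold qInt
  split_ifs
  · push_cast; ring
  · rw [neg_neg]; ring

theorem T_comm (i j : Var) (c e : ℤ) (φ : Fld q) :
    T q i c (T q j e φ) = T q j e (T q i c φ) := by
  ext n
  simp only [T, coeff_diagOp]
  rw [smul_comm]

theorem Iplus_slice : Iplus q 0 (slice q d 0 0 f)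
    = (1 / 2 * q * qInt q 2) • (P₁ q (slice q d 0 0 f) + x q .zb * P₂ q (slice q d 0 0 f)) := by
  simp [Iplus, P₁, P₂, mul_assoc, zpow_neg]
  module

theorem Iplus_z_mul_slice : Iplus q 0 (x q .z * slice q d 0 0 f)
    = (1 / 2 * q * qInt q 1) • (x q .z * P₁ q (slice q d 0 0 f)
        + x q .z * (x q .zb * P₂ q (slice q d 0 0 f)))
      - (1 / 2 * q ^ 3 * qInt q 1) •
        (P₃ q (slice q d 0 0 f) + x q .zb * P₄ q (slice q d 0 0 f)) := by
  simp [Iplus, P₁, P₂, P₃, P₄, mul_add, mul_assoc, zpow_neg]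
  module

theorem Iplus_z_mul_z_mul_slice : Iplus q 0 (x q .z * (x q .z * slice q d 0 0 f))
    = - (1 / 2 * q ^ 3 * qInt q 2) •
        (x q .z * P₃ q (slice q d 0 0 f) + x q .z * (x q .zb * P₄ q (slice q d 0 0 f))) := by
  simp [Iplus, P₃, P₄, mul_add, mul_assoc, qInt_zero, zpow_neg]
  module

theorem Iminus_slice : Iminus q 0 (slice q d 0 0 f)
    = (1 / 2 * qInt q 2) • (R₂ q (slice q d 0 0 f) + x q .z * R₄ q (slice q d 0 0 f)) := by
  simp [Iminus, R₂, R₄, mul_assoc, zpow_neg]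
  module

theorem Iminus_zb_mul_slice : Iminus q 0 (x q .zb * slice q d 0 0 f)
    = (1 / 2 * q * qInt q 1) • (x q .zb * R₂ q (slice q d 0 0 f)
        + x q .z * (x q .zb * R₄ q (slice q d 0 0 f)))
      - (1 / 2 * (q ^ 2)⁻¹ * q * qInt q 1) •
        (R₁ q (slice q d 0 0 f) + x q .z * R₃ q (slice q d 0 0 f)) := by
  simp [Iminus, R₁, R₂, R₃, R₄, mul_add, mul_assoc, zpow_neg]
  module

theorem Iminus_zb_mul_zb_mul_slice : Iminus q 0 (x q .zb * (x q .zb * slice q d 0 0 f))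
    = - (1 / 2 * (q ^ 2)⁻¹ * q ^ 2 * qInt q 2) •
        (x q .zb * R₁ q (slice q d 0 0 f) + x q .z * (x q .zb * R₃ q (slice q d 0 0 f))) := by
  simp [Iminus, R₁, R₃, mul_assoc, qInt_zero, zpow_neg]
  norm_cast
  module

theorem I13_zb_mul_z_mul_slice : I13 q (x q .zb * x q .z * slice q d 0 0 f)
    = (q ^ 2 * qInt q 1 ^ 2) • R₁ q (slice q d 0 0 f) := by
  simp [I13, R₁, mul_assoc, qInt_zero, zpow_neg]
  module

theorem I13_z_mul_slice (hq0 : q ≠ 0) : I13 q (x q .z * slice q d 0 0 f)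
    = -(q ^ 2 * qInt q 1 ^ 2) • R₂ q (slice q d 0 0 f) := by
  simp [I13, R₂, mul_assoc, qInt_zero, qInt_neg, zpow_neg]
  match_scalars <;> field_simp

theorem I13_zb_mul_slice : I13 q (x q .zb * slice q d 0 0 f)
    = -(q * qInt q 1 ^ 2) • R₃ q (slice q d 0 0 f) := by
  have h (φ : Fld q) : R₃ q φ = D q .v (T q .vb 1 (T q .xp 1 (T q .xm (-1) φ))) := by
    rw [T_comm .xp .xm, T_comm .vb .xm]
    rfl
  rw [h]
  simp [I13, mul_assoc, qInt_zero, qInt_neg, zpow_neg]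
  module

theorem I13_slice : I13 q (slice q d 0 0 f)
    = (q * qInt q 1 ^ 2) • R₄ q (slice q d 0 0 f) := by
  have h (φ : Fld q) : R₄ q φ = D q .xp (T q .xp 1 (T q .v 1 φ)) := by
    rw [T_comm .xp .v]
    rfl
  rw [h]
  simp [I13, mul_assoc, qInt_neg, zpow_neg]
  module

/-! ### q-numbers away from nontrivial roots of unity -/

theorem lam_ne_zero (hq0 : q ≠ 0) (hq : ∀ n : ℕ, 0 < n → q ^ n = 1 → q = 1) (h1 : q ≠ 1) :
    q - q⁻¹ ≠ 0 := by
  intro h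
  refine h1 (hq 2 two_pos ?_)
  field_simp at h
  linear_combination h

theorem qInt_succ_ne_zero (hq0 : q ≠ 0) (hq : ∀ n : ℕ, 0 < n → q ^ n = 1 → q = 1) (n : ℕ) :
    qInt q ((n : ℤ) + 1) ≠ 0 := by
  unfold qInt
  split_ifs with h1
  · push_cast
    exact Nat.cast_add_one_ne_zero n
  · refine div_ne_zero (fun h => h1 (hq (2 * (n + 1)) (by omega) ?_)) (lam_ne_zero hq0 hq h1)
    have h2 : q ^ ((n : ℤ) + 1) = q ^ (n + 1) := by exact_mod_cast zpow_natCast q (n + 1)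
    rw [zpow_neg, h2, sub_eq_zero] at h
    rw [two_mul, pow_add]
    nth_rewrite 1 [h]
    exact inv_mul_cancel₀ (pow_ne_zero _ hq0)

theorem lam_mul_qInt (hq0 : q ≠ 0) (hq : ∀ n : ℕ, 0 < n → q ^ n = 1 → q = 1) (n : ℤ) :
    lam q * qInt q n = q ^ n - q ^ (-n) := by
  unfold qInt lam
  split_ifs with h1
  · simp [h1]
  · rw [mul_comm, div_mul_cancel₀ _ (lam_ne_zero hq0 hq h1)]

theorem qFact_succ (n : ℕ) : qFact q (n + 1) = qFact q n * qInt q ((n : ℤ) + 1) := by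
  rw [qFact, Finset.prod_range_succ, qFact]

theorem qInt_mul_inv_qFact_succ (hq0 : q ≠ 0) (hq : ∀ n : ℕ, 0 < n → q ^ n = 1 → q = 1) (n : ℕ) :
    qInt q ((n : ℤ) + 1) * (qFact q (n + 1))⁻¹ = (qFact q n)⁻¹ := by
  rw [qFact_succ, mul_inv, mul_comm, mul_assoc, inv_mul_cancel₀ (qInt_succ_ne_zero hq0 hq n),
    mul_one]

theorem invGammaQ_succ (n : ℕ) : invGammaQ q ((n : ℤ) + 1) = (qFact q n)⁻¹ := by
  rw [invGammaQ, if_neg (by omega), add_sub_cancel_right, Int.toNat_natCast]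

theorem invGammaQ_of_nonpos {p : ℤ} (h : p ≤ 0) : invGammaQ q p = 0 := if_pos h

/-! ### Relations of the momenta -/

theorem k_p_mul_v : k q .p * k q .v = q • (k q .v * k q .p) := by
  have := RingQuot.mkAlgHom_rel ℂ (MomRel.p_v (q := q))
  rwa [map_smul, map_mul, map_mul] at this

theorem k_m_mul_v : k q .m * k q .v = q⁻¹ • (k q .v * k q .m) := by
  have := RingQuot.mkAlgHom_rel ℂ (MomRel.m_v (q := q))
  rwa [map_smul, map_mul, map_mul] at this

theorem k_p_mul_vb : k q .p * k q .vb = q • (k q .vb * k q .p) := by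
  have := RingQuot.mkAlgHom_rel ℂ (MomRel.p_vb (q := q))
  rwa [map_smul, map_mul, map_mul] at this

theorem k_m_mul_vb : k q .m * k q .vb = q⁻¹ • (k q .vb * k q .m) := by
  have := RingQuot.mkAlgHom_rel ℂ (MomRel.m_vb (q := q))
  rwa [map_smul, map_mul, map_mul] at this

theorem k_vb_mul_v : k q .vb * k q .v = k q .v * k q .vb := by
  have := RingQuot.mkAlgHom_rel ℂ (MomRel.vb_v (q := q))
  rwa [map_mul, map_mul] at this

theorem k_m_mul_p : k q .m * k q .p = q⁻¹ • (k q .v * k q .vb) := by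
  have := RingQuot.mkAlgHom_rel ℂ (MomRel.cone (q := q))
  rwa [map_smul, map_mul, map_mul] at this

theorem k_p_mul_m : k q .p * k q .m = q • (k q .v * k q .vb) := by
  have h := RingQuot.mkAlgHom_rel ℂ (MomRel.p_m (q := q))
  rw [map_smul, map_sub, map_mul, map_mul, map_mul] at h
  change k q .p * k q .m - k q .m * k q .p = lam q • (k q .v * k q .vb) at h
  rw [k_m_mul_p, sub_eq_iff_eq_add] at h
  rw [h, ← add_smul, lam]
  congr 1
  ring

theorem pow_mul_eq_smul {A : Type*} [Ring A] [Algebra ℂ A] {a b : A} {c : ℂ}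
    (h : a * b = c • (b * a)) (n : ℕ) : a ^ n * b = c ^ n • (b * a ^ n) := by
  induction n with
  | zero => simp
  | succ n ih =>
    rw [pow_succ, mul_assoc, h, mul_smul_comm, ← mul_assoc, ih, smul_mul_assoc, smul_smul,
      mul_assoc, ← pow_succ']

/-- The normally ordered momentum word `k_v̄^n k_+^m k_-^p k_v^l`. -/
def word (q : ℂ) (l p m n : ℕ) : MomAlg q := k q .vb ^ n * k q .p ^ m * k q .m ^ p * k q .v ^ l

theorem word_succ_vb (l p m n : ℕ) : word q l p m (n + 1) = k q .vb * word q l p m n := by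
  simp only [word, pow_succ', mul_assoc]

theorem word_succ_p (hq0 : q ≠ 0) (l p m n : ℕ) :
    word q l p (m + 1) n = q ^ (-n : ℤ) • (k q .p * word q l p m n) := by
  have h : k q .vb * k q .p = q⁻¹ • (k q .p * k q .vb) := by
    rw [k_p_mul_vb, smul_smul, inv_mul_cancel₀ hq0, one_smul]
  simp only [word]
  rw [pow_succ', ← mul_assoc (k q .vb ^ n), pow_mul_eq_smul h, zpow_neg, zpow_natCast, inv_pow]
  simp only [smul_mul_assoc, mul_assoc]

theorem word_succ_m (hq0 : q ≠ 0) (l p m n : ℕ) :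
    word q l (p + 1) m n = q ^ (2 * m + n : ℤ) • (k q .m * word q l p m n) := by
  have h : k q .vb * k q .m = q • (k q .m * k q .vb) := by
    rw [k_m_mul_vb, smul_smul, mul_inv_cancel₀ hq0, one_smul]
  have h' : k q .p * k q .m = (q ^ 2) • (k q .m * k q .p) := by
    rw [k_p_mul_m, k_m_mul_p, smul_smul]
    congr 1
    field_simp
  have e : q ^ (2 * m + n : ℤ) = (q ^ 2) ^ m * q ^ n := by
    rw [← pow_mul]
    exact_mod_cast pow_add q (2 * m) n
  simp only [word, e]
  rw [pow_succ', ← mul_assoc, mul_assoc (k q .vb ^ n), pow_mul_eq_smul h', mul_smul_comm,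
    ← mul_assoc (k q .vb ^ n), pow_mul_eq_smul h]
  simp only [smul_mul_assoc, mul_assoc, smul_smul]

theorem word_succ_v (hq0 : q ≠ 0) (l p m n : ℕ) :
    word q (l + 1) p m n = q ^ (m - p : ℤ) • (k q .v * word q l p m n) := by
  have h1 : k q .vb ^ n * k q .v = k q .v * k q .vb ^ n :=
    Commute.pow_left (k_vb_mul_v (q := q)) n
  have e : q ^ (m - p : ℤ) = q⁻¹ ^ p * q ^ m := by
    rw [sub_eq_add_neg, zpow_add₀ hq0, zpow_neg, zpow_natCast, zpow_natCast, inv_pow, mul_comm]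
  simp only [word, e]
  rw [pow_succ', ← mul_assoc, mul_assoc _ (k q .m ^ p) (k q .v), pow_mul_eq_smul k_m_mul_v,
    mul_smul_comm, ← mul_assoc _ (k q .v), mul_assoc (k q .vb ^ n), pow_mul_eq_smul k_p_mul_v,
    mul_smul_comm,
    ← mul_assoc (k q .vb ^ n), h1]
  simp only [smul_mul_assoc, mul_assoc, smul_smul]

theorem kk_mul_kk (κ μ : Mom) : kk q κ * kk q μ = momElt q 2 (k q κ * k q μ) := by
  rw [kk, kk, momElt, momElt, momElt, monomial_mul_monomial, ← Finsupp.single_add]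

theorem momElt_mul (c d : ℕ) (A B : MomAlg q) :
    momElt q c A * momElt q d B = momElt q (c + d) (A * B) := by
  rw [momElt, momElt, momElt, monomial_mul_monomial, ← Finsupp.single_add]

theorem momElt_smul (c : ℕ) (r : ℂ) (A : MomAlg q) : momElt q c (r • A) = r • momElt q c A := by
  classical
  ext e
  rw [coeff_smul', momElt, momElt, coeff_monomial, coeff_monomial, smul_ite, smul_zero]

theorem momElt_add (c : ℕ) (A B : MomAlg q) :
    momElt q c (A + B) = momElt q c A + momElt q c B := map_add _ _ _

theorem momElt_neg (c : ℕ) (A : MomAlg q) : momElt q c (-A) = -momElt q c A := map_neg _ _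

theorem kk_pow (κ : Mom) (n : ℕ) : kk q κ ^ n = momElt q n (k q κ ^ n) := by
  induction n with
  | zero => rw [pow_zero, pow_zero, momElt, Finsupp.single_zero]; rfl
  | succ n ih => rw [pow_succ, ih, kk, momElt_mul, pow_succ]

theorem kk_p_mul_v : kk q .p * kk q .v = q • (kk q .v * kk q .p) := by
  rw [kk_mul_kk, kk_mul_kk, ← momElt_smul, k_p_mul_v]

theorem kk_m_mul_v : kk q .m * kk q .v = q⁻¹ • (kk q .v * kk q .m) := by
  rw [kk_mul_kk, kk_mul_kk, ← momElt_smul, k_m_mul_v]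

theorem kk_p_mul_vb : kk q .p * kk q .vb = q • (kk q .vb * kk q .p) := by
  rw [kk_mul_kk, kk_mul_kk, ← momElt_smul, k_p_mul_vb]

theorem kk_m_mul_vb : kk q .m * kk q .vb = q⁻¹ • (kk q .vb * kk q .m) := by
  rw [kk_mul_kk, kk_mul_kk, ← momElt_smul, k_m_mul_vb]

theorem kk_vb_mul_v : kk q .vb * kk q .v = kk q .v * kk q .vb := by
  rw [kk_mul_kk, kk_mul_kk, k_vb_mul_v]

theorem kk_m_mul_p : kk q .m * kk q .p = q⁻¹ • (kk q .v * kk q .vb) := by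
  rw [kk_mul_kk, kk_mul_kk, ← momElt_smul, k_m_mul_p]

theorem kk_p_mul_m : kk q .p * kk q .m = q • (kk q .v * kk q .vb) := by
  rw [kk_mul_kk, kk_mul_kk, ← momElt_smul, k_p_mul_m]

/-! ### The plane wave components as slices -/

/-- The number in front of the momentum word in the coefficient of `h̃_s` at
`v̄^l x_+^p x_-^m v^n`. -/
def waveCoeff (q : ℂ) (Q : ℕ → ℕ → ℕ → ℤ) (s l p m n : ℕ) : ℂ :=
  beta q s * ((-1) ^ l * (-1) ^ n)
    * q ^ ((n * m - n * p - n * l - m * l - m * p + p * l - m + p : ℤ))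
    * q ^ Q s (m + n) (p + n)
    * ((qFact q l)⁻¹ * (qFact q p)⁻¹ * (qFact q m)⁻¹ * (qFact q n)⁻¹)

/-- The coefficient of `h̃_s` at `v̄^l x_+^p x_-^m v^n`. -/
def waveFun (q : ℂ) (Q : ℕ → ℕ → ℕ → ℤ) (s l p m n : ℕ) : MomAlg q :=
  if l + p + m + n = s then waveCoeff q Q s l p m n • word q l p m n else 0

theorem kk_pows_mul_x_pows (n i j r l p m o : ℕ) :
    kk q .vb ^ n * kk q .p ^ i * kk q .m ^ j * kk q .v ^ r
      * (x q .vb ^ l * x q .xp ^ p * x q .xm ^ m * x q .v ^ o)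
    = monomial (Finsupp.single .t (n + i + j + r) + (Finsupp.single .vb l + Finsupp.single .xp p
        + Finsupp.single .xm m + Finsupp.single .v o))
        (k q .vb ^ n * k q .p ^ i * k q .m ^ j * k q .v ^ r) := by
  simp only [kk_pow, momElt, x, X_pow_eq, monomial_mul_monomial, mul_one, ← Finsupp.single_add]

theorem eq_exponent_iff (e : Var →₀ ℕ) (d l p m o : ℕ) :
    e = Finsupp.single .t d + (Finsupp.single .vb l + Finsupp.single .xp p
        + Finsupp.single .xm m + Finsupp.single .v o)
      ↔ e .t = d ∧ e .vb = l ∧ e .xp = p ∧ e .xm = m ∧ e .v = o ∧ e .z = 0 ∧ e .zb = 0 := by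
  constructor
  · rintro rfl
    simp []
  · rintro ⟨h1, h2, h3, h4, h5, h6, h7⟩
    ext i
    cases i <;> simp [*]

theorem th_eq_slice (Q : ℕ → ℕ → ℕ → ℤ) (s : ℕ) :
    th q Q s = slice q s 0 0 (waveFun q Q s) := by
  classical
  ext e
  rw [th, coeff_smul', map_sum, coeff_slice]
  simp only [map_sum, kk_pows_mul_x_pows, coeff_smul', coeff_monomial, eq_exponent_iff]
  by_cases he : (e .t = s ∧ e .z = 0 ∧ e .zb = 0) ∧ e .vb + e .xp + e .xm + e .v = s
  · obtain ⟨he, hs⟩ := he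
    rw [if_pos he, waveFun, if_pos hs]
    obtain ⟨h1, h2, h3⟩ := he
    rw [Finset.sum_eq_single (e .xm + e .v), Finset.sum_eq_single (e .xp + e .v),
      Finset.sum_eq_single (e .v)]
    · rw [if_pos (by omega), smul_smul]
      have a1 : e .xm + e .v - e .v = e .xm := by omega
      have a2 : e .xp + e .v - e .v = e .xp := by omega
      have a3 : s + e .v - (e .xm + e .v) - (e .xp + e .v) = e .vb := by omega
      have b1 : ((e .xm + e .v : ℕ) : ℤ) - (e .v : ℤ) + 1 = (e .xm : ℤ) + 1 := by omega
      have b2 : ((e .xp + e .v : ℕ) : ℤ) - (e .v : ℤ) + 1 = (e .xp : ℤ) + 1 := by omega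
      have b3 : (s : ℤ) - ((e .xm + e .v : ℕ) : ℤ) - ((e .xp + e .v : ℕ) : ℤ) + (e .v : ℤ) + 1
          = (e .vb : ℤ) + 1 := by omega
      have b4 : (s : ℤ) - ((e .xm + e .v : ℕ) : ℤ) - ((e .xp + e .v : ℕ) : ℤ)
          = (e .vb : ℤ) - (e .v : ℤ) := by omega
      have b5 : (-1 : ℂ) ^ ((e .vb : ℤ) - (e .v : ℤ)) = (-1) ^ e .vb * (-1) ^ e .v := by
        rw [zpow_sub₀ (by norm_num), zpow_natCast, zpow_natCast, div_eq_mul_inv, ← inv_pow,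
          inv_neg_one]
      have b6 : (s : ℤ) = e .vb + e .xp + e .xm + e .v := by omega
      rw [a1, a2, a3, b1, b2, b3, b4, b5, invGammaQ_succ, invGammaQ_succ, invGammaQ_succ,
        waveCoeff, word]
      congr 1
      rw [show ((e .v : ℤ) * (2 * ((e .xm + e .v : ℕ) : ℤ) + 2 * ((e .xp + e .v : ℕ) : ℤ)
          - 2 * (e .v : ℤ) - s) + ((e .xm + e .v : ℕ) : ℤ) * (((e .xm + e .v : ℕ) : ℤ) - s - 1)
          + ((e .xp + e .v : ℕ) : ℤ) * ((e .vb : ℤ) - (e .v : ℤ) + 1))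
          = (e .v * e .xm - e .v * e .xp - e .v * e .vb - e .xm * e .vb - e .xm * e .xp
            + e .xp * e .vb - e .xm + e .xp : ℤ) by rw [b6]; push_cast; ring]
      ring
    · intro n _ hn
      rw [if_neg (by omega), smul_zero]
    · intro h
      exact absurd (Finset.mem_range.2 (by omega)) h
    · intro b _ hb
      refine Finset.sum_eq_zero fun n _ => ?_
      by_cases hbn : b < n
      · rw [invGammaQ_of_nonpos (p := (b : ℤ) - n + 1) (by omega)]
        simp
      · rw [if_neg (by omega), smul_zero]
    · intro h
      exact absurd (Finset.mem_range.2 (by omega)) h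
    · intro a _ ha
      refine Finset.sum_eq_zero fun b _ => Finset.sum_eq_zero fun n _ => ?_
      by_cases han : a < n
      · rw [invGammaQ_of_nonpos (p := (a : ℤ) - n + 1) (by omega)]
        simp
      · rw [if_neg (by omega), smul_zero]
    · intro h
      exact absurd (Finset.mem_range.2 (by omega)) h
  · have hr : (if e .t = s ∧ e .z = 0 ∧ e .zb = 0
        then waveFun q Q s (e .vb) (e .xp) (e .xm) (e .v) else 0) = 0 := by
      split_ifs with h
      · exact if_neg fun h' => he ⟨h, h'⟩
      · rfl
    rw [hr]
    refine smul_eq_zero_of_right _ (Finset.sum_eq_zero fun a _ => Finset.sum_eq_zero fun b _ =>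
      Finset.sum_eq_zero fun n _ => ?_)
    by_cases han : a < n
    · rw [invGammaQ_of_nonpos (p := (a : ℤ) - n + 1) (by omega)]
      simp
    by_cases hbn : b < n
    · rw [invGammaQ_of_nonpos (p := (b : ℤ) - n + 1) (by omega)]
      simp
    by_cases hs : s + n < a + b
    · rw [invGammaQ_of_nonpos (p := (s : ℤ) - a - b + n + 1) (by omega)]
      simp
    rw [if_neg (by omega), smul_zero]

/-- The ratio `β̃^{s+1} / β̃^s`. -/
def betaRatio (q : ℂ) (s : ℕ) : ℂ := beta q (s + 1) / beta q s

theorem betaRatio_mul_beta (hβ : ∀ s, betaInv q s ≠ 0) (s : ℕ) :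
    betaRatio q s * beta q s = beta q (s + 1) :=
  div_mul_cancel₀ _ (inv_ne_zero (hβ s))

/-- `waveFun` for `Q = 0`. -/
abbrev waveFun₀ (q : ℂ) : ℕ → ℕ → ℕ → ℕ → ℕ → MomAlg q := waveFun q fun _ _ _ => 0

theorem smul_mul_waveFun_congr {c e : ℂ} {A : MomAlg q} {s l p m n : ℕ}
    (h : s = l + p + m + n → c = e) :
    c • (A * waveFun₀ q s l p m n) = e • (A * waveFun₀ q s l p m n) := by
  by_cases hs : s = l + p + m + n
  · rw [h hs]
  · rw [waveFun₀, waveFun, if_neg (fun h' => hs h'.symm), mul_zero, smul_zero, smul_zero]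

theorem waveFun_eq_smul (s l p m n : ℕ) : waveFun q (fun _ a _ => -2 * (a : ℤ)) s l p m n
    = q ^ (-2 * ((m : ℤ) + n)) • waveFun₀ q s l p m n := by
  unfold waveFun₀ waveFun waveCoeff
  rw [smul_ite, smul_zero, smul_smul, zpow_zero]
  push_cast
  congr 2
  ring

theorem qInt_smul_waveFun_succ_v (hq0 : q ≠ 0) (hq : ∀ n : ℕ, 0 < n → q ^ n = 1 → q = 1)
    (hβ : ∀ s, betaInv q s ≠ 0) (s l p m n : ℕ) :
    qInt q ((n : ℤ) + 1) • waveFun₀ q (s + 1) l p m (n + 1)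
    = (-betaRatio q s * q ^ (m - p - l : ℤ)) • (k q .vb * waveFun₀ q s l p m n) := by
  unfold waveFun₀ waveFun
  by_cases h : l + p + m + n = s
  · rw [if_pos (by omega), if_pos h, word_succ_vb, mul_smul_comm, smul_smul, smul_smul]
    congr 1
    simp only [waveCoeff]
    rw [← qInt_mul_inv_qFact_succ hq0 hq n, ← betaRatio_mul_beta hβ, zpow_zero]
    have e : q ^ (((n + 1 : ℕ) * m - (n + 1 : ℕ) * p - (n + 1 : ℕ) * l - m * l - m * p + p * l
        - m + p : ℤ)) = q ^ (m - p - l : ℤ)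
        * q ^ ((n * m - n * p - n * l - m * l - m * p + p * l - m + p : ℤ)) := by
      rw [← zpow_add₀ hq0]
      congr 1
      push_cast
      ring
    rw [e]
    ring
  · rw [if_neg (by omega), if_neg h, mul_zero, smul_zero, smul_zero]

theorem qInt_smul_waveFun_succ_m (hq0 : q ≠ 0) (hq : ∀ n : ℕ, 0 < n → q ^ n = 1 → q = 1)
    (hβ : ∀ s, betaInv q s ≠ 0) (s l p m n : ℕ) :
    qInt q ((m : ℤ) + 1) • waveFun₀ q (s + 1) l p (m + 1) n
    = (betaRatio q s * q ^ (-l - p - 1 : ℤ)) • (k q .p * waveFun₀ q s l p m n) := by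
  unfold waveFun₀ waveFun
  by_cases h : l + p + m + n = s
  · rw [if_pos (by omega), if_pos h, word_succ_p hq0, mul_smul_comm, smul_smul, smul_smul,
      smul_smul]
    congr 1
    simp only [waveCoeff]
    rw [← qInt_mul_inv_qFact_succ hq0 hq m, ← betaRatio_mul_beta hβ, zpow_zero]
    have e : q ^ ((n * (m + 1 : ℕ) - n * p - n * l - (m + 1 : ℕ) * l - (m + 1 : ℕ) * p + p * l
        - (m + 1 : ℕ) + p : ℤ)) * q ^ (-n : ℤ) = q ^ (-l - p - 1 : ℤ)
        * q ^ ((n * m - n * p - n * l - m * l - m * p + p * l - m + p : ℤ)) := by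
      rw [← zpow_add₀ hq0, ← zpow_add₀ hq0]
      congr 1
      push_cast
      ring
    linear_combination (qInt q ((m : ℤ) + 1) * (betaRatio q s * beta q s * ((-1) ^ l * (-1) ^ n)) *
      ((qFact q l)⁻¹ * (qFact q p)⁻¹ * (qFact q (m + 1))⁻¹ * (qFact q n)⁻¹)) * e
  · rw [if_neg (by omega), if_neg h, mul_zero, smul_zero, smul_zero]

theorem qInt_smul_waveFun_succ_p (hq0 : q ≠ 0) (hq : ∀ n : ℕ, 0 < n → q ^ n = 1 → q = 1)
    (hβ : ∀ s, betaInv q s ≠ 0) (s l p m n : ℕ) :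
    qInt q ((p : ℤ) + 1) • waveFun₀ q (s + 1) l (p + 1) m n
    = (betaRatio q s * q ^ (m + l + 1 : ℤ)) • (k q .m * waveFun₀ q s l p m n) := by
  unfold waveFun₀ waveFun
  by_cases h : l + p + m + n = s
  · rw [if_pos (by omega), if_pos h, word_succ_m hq0, mul_smul_comm, smul_smul, smul_smul,
      smul_smul]
    congr 1
    simp only [waveCoeff]
    rw [← qInt_mul_inv_qFact_succ hq0 hq p, ← betaRatio_mul_beta hβ, zpow_zero]
    have e : q ^ ((n * m - n * (p + 1 : ℕ) - n * l - m * l - m * (p + 1 : ℕ) + (p + 1 : ℕ) * l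
        - m + (p + 1 : ℕ) : ℤ)) * q ^ (2 * m + n : ℤ) = q ^ (m + l + 1 : ℤ)
        * q ^ ((n * m - n * p - n * l - m * l - m * p + p * l - m + p : ℤ)) := by
      rw [← zpow_add₀ hq0, ← zpow_add₀ hq0]
      congr 1
      push_cast
      ring
    linear_combination (qInt q ((p : ℤ) + 1) * (betaRatio q s * beta q s * ((-1) ^ l * (-1) ^ n)) *
      ((qFact q l)⁻¹ * (qFact q (p + 1))⁻¹ * (qFact q m)⁻¹ * (qFact q n)⁻¹)) * e
  · rw [if_neg (by omega), if_neg h, mul_zero, smul_zero, smul_zero]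

theorem qInt_smul_waveFun_succ_vb (hq0 : q ≠ 0) (hq : ∀ n : ℕ, 0 < n → q ^ n = 1 → q = 1)
    (hβ : ∀ s, betaInv q s ≠ 0) (s l p m n : ℕ) :
    qInt q ((l : ℤ) + 1) • waveFun₀ q (s + 1) (l + 1) p m n
    = (-betaRatio q s * q ^ (-n : ℤ)) • (k q .v * waveFun₀ q s l p m n) := by
  unfold waveFun₀ waveFun
  by_cases h : l + p + m + n = s
  · rw [if_pos (by omega), if_pos h, word_succ_v hq0, mul_smul_comm, smul_smul, smul_smul,
      smul_smul]
    congr 1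
    simp only [waveCoeff]
    rw [← qInt_mul_inv_qFact_succ hq0 hq l, ← betaRatio_mul_beta hβ, zpow_zero]
    have e : q ^ ((n * m - n * p - n * (l + 1 : ℕ) - m * (l + 1 : ℕ) - m * p + p * (l + 1 : ℕ)
        - m + p : ℤ)) * q ^ (m - p : ℤ) = q ^ (-n : ℤ)
        * q ^ ((n * m - n * p - n * l - m * l - m * p + p * l - m + p : ℤ)) := by
      rw [← zpow_add₀ hq0, ← zpow_add₀ hq0]
      congr 1
      push_cast
      ring
    linear_combination (-qInt q ((l : ℤ) + 1) * (betaRatio q s * beta q s * ((-1) ^ l * (-1) ^ n)) *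
      ((qFact q (l + 1))⁻¹ * (qFact q p)⁻¹ * (qFact q m)⁻¹ * (qFact q n)⁻¹)) * e
  · rw [if_neg (by omega), if_neg h, mul_zero, smul_zero, smul_zero]

theorem qInt_smul_qInt_smul_waveFun_succ_m_p (hq0 : q ≠ 0) (hq : ∀ n : ℕ, 0 < n → q ^ n = 1 → q = 1)
    (hβ : ∀ s, betaInv q s ≠ 0) (s l p m n : ℕ) :
    qInt q ((m : ℤ) + 1) • qInt q ((p : ℤ) + 1) • waveFun₀ q (s + 1) l (p + 1) (m + 1) n
    = (-betaRatio q s * q ^ (l : ℤ) * qInt q ((n : ℤ) + 1)) •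
      (k q .v * waveFun₀ q s l p m (n + 1)) := by
  unfold waveFun₀ waveFun
  by_cases h : l + p + m + (n + 1) = s
  · have hw : word q l (p + 1) (m + 1) n
        = q ^ (2 * m + 1 : ℤ) • (k q .v * word q l p m (n + 1)) := by
      rw [word_succ_m hq0, word_succ_p hq0, word_succ_vb, mul_smul_comm, ← mul_assoc, k_m_mul_p,
        smul_mul_assoc, smul_smul, smul_smul, mul_assoc (k q .v), ← zpow_neg_one, ← zpow_add₀ hq0,
        ← zpow_add₀ hq0]
      congr 2
      push_cast
      ring
    rw [if_pos (by omega), if_pos h, hw, mul_smul_comm, smul_smul, smul_smul,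
      smul_smul, smul_smul]
    congr 1
    simp only [waveCoeff]
    rw [← betaRatio_mul_beta hβ, zpow_zero, ← qInt_mul_inv_qFact_succ hq0 hq p,
      ← qInt_mul_inv_qFact_succ hq0 hq m, ← qInt_mul_inv_qFact_succ hq0 hq n]
    have e : q ^ ((n * (m + 1 : ℕ) - n * (p + 1 : ℕ) - n * l - (m + 1 : ℕ) * l
        - (m + 1 : ℕ) * (p + 1 : ℕ) + (p + 1 : ℕ) * l
        - (m + 1 : ℕ) + (p + 1 : ℕ) : ℤ)) * q ^ (2 * m + 1 : ℤ) = q ^ (l : ℤ)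
        * q ^ (((n + 1 : ℕ) * m - (n + 1 : ℕ) * p - (n + 1 : ℕ) * l - m * l - m * p + p * l - m
          + p : ℤ)) := by
      rw [← zpow_add₀ hq0, ← zpow_add₀ hq0]
      congr 1
      push_cast
      ring
    linear_combination (qInt q ((p : ℤ) + 1) * qInt q ((m : ℤ) + 1) * qInt q ((n : ℤ) + 1)
      * (betaRatio q s * beta q s * ((-1) ^ l * (-1) ^ n)) *
      ((qFact q l)⁻¹ * (qFact q (p + 1))⁻¹ * (qFact q (m + 1))⁻¹ * (qFact q (n + 1))⁻¹)) * e
  · rw [if_neg (by omega), if_neg h, mul_zero, smul_zero, smul_zero, smul_zero]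

theorem P₁_thA (hq0 : q ≠ 0) (hq : ∀ n : ℕ, 0 < n → q ^ n = 1 → q = 1)
    (hβ : ∀ s, betaInv q s ≠ 0) (s : ℕ) : P₁ q (thA q (s + 1))
      = (-betaRatio q s * q ^ (-s - 1 : ℤ)) • (kk q .vb * th0 q s) := by
  rw [thA, th0, th_eq_slice, th_eq_slice]
  simp only [P₁, Module.End.mul_apply, T_v_slice, D_v_slice, kk_mul_slice, ← slice_smul]
  congr
  funext l p m n
  rw [waveFun_eq_smul, smul_comm, smul_comm (qInt _ _), qInt_smul_waveFun_succ_v hq0 hq hβ,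
    smul_smul, smul_smul]
  refine smul_mul_waveFun_congr fun h => ?_
  have e : q ^ (-s - 1 : ℤ) = q ^ (1 * ((n + 1 : ℕ) : ℤ)) * q ^ (-2 * ((m : ℤ) + (n + 1 : ℕ)))
      * q ^ (m - p - l : ℤ) := by
    rw [← zpow_add₀ hq0, ← zpow_add₀ hq0, h]
    congr 1
    push_cast
    ring
  rw [e]
  ring

theorem P₂_thA (hq0 : q ≠ 0) (hq : ∀ n : ℕ, 0 < n → q ^ n = 1 → q = 1)
    (hβ : ∀ s, betaInv q s ≠ 0) (s : ℕ) : P₂ q (thA q (s + 1))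
      = (betaRatio q s * q) • (kk q .m * th0 q s) := by
  rw [thA, th0, th_eq_slice, th_eq_slice]
  simp only [P₂, Module.End.mul_apply, T_v_slice, T_xm_slice, T_vb_slice, D_xp_slice, kk_mul_slice,
    ← slice_smul]
  congr
  funext l p m n
  simp only [waveFun_eq_smul, smul_comm (qInt _ _)]
  rw [qInt_smul_waveFun_succ_p hq0 hq hβ]
  simp only [smul_smul]
  refine smul_mul_waveFun_congr fun h => ?_
  have e : q = q ^ (1 * (m : ℤ)) * q ^ (-1 * (l : ℤ)) * q ^ (1 * (n : ℤ)) * q ^ (1 * (n : ℤ))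
      * q ^ (-2 * ((m : ℤ) + n)) * q ^ (m + l + 1 : ℤ) := by
    simp only [← zpow_add₀ hq0]
    nth_rewrite 1 [← zpow_one q]
    congr 1
    ring
  linear_combination (-betaRatio q s) * e

theorem P₃_thA (hq0 : q ≠ 0) (hq : ∀ n : ℕ, 0 < n → q ^ n = 1 → q = 1)
    (hβ : ∀ s, betaInv q s ≠ 0) (s : ℕ) : P₃ q (thA q (s + 1))
      = (betaRatio q s * q ^ (-s - 2 : ℤ)) • (kk q .p * th0 q s) := by
  rw [thA, th0, th_eq_slice, th_eq_slice]
  simp only [P₃, Module.End.mul_apply, T_v_slice, T_xm_slice, D_xm_slice, kk_mul_slice,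
    ← slice_smul]
  congr
  funext l p m n
  simp only [waveFun_eq_smul, smul_comm (qInt _ _)]
  rw [qInt_smul_waveFun_succ_m hq0 hq hβ]
  simp only [smul_smul]
  refine smul_mul_waveFun_congr fun h => ?_
  have e : q ^ (-s - 2 : ℤ) = q ^ (1 * ((m + 1 : ℕ) : ℤ)) * q ^ (1 * (n : ℤ))
      * q ^ (-2 * (((m + 1 : ℕ) : ℤ) + n)) * q ^ (-l - p - 1 : ℤ) := by
    simp only [← zpow_add₀ hq0]
    congr 1
    push_cast [h]
    ring
  linear_combination (-betaRatio q s) * e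

theorem P₄_thA (hq0 : q ≠ 0) (hq : ∀ n : ℕ, 0 < n → q ^ n = 1 → q = 1)
    (hβ : ∀ s, betaInv q s ≠ 0) (s : ℕ) : P₄ q (thA q (s + 1))
      = -betaRatio q s • (kk q .v * th0 q s) := by
  rw [thA, th0, th_eq_slice, th_eq_slice]
  simp only [P₄, Module.End.mul_apply, LinearMap.add_apply, LinearMap.smul_apply, M_apply,
    T_v_slice, T_xm_slice, T_vb_slice, D_xm_slice, D_xp_slice, D_vb_slice, x_v_mul_slice,
    kk_mul_slice, ← slice_smul, ← slice_add]
  congr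
  funext l p m n
  have h1 := qInt_smul_waveFun_succ_vb hq0 hq hβ s l p m n
  simp only [waveFun_eq_smul]
  rcases n with _ | n
  · simp only [if_true, Nat.cast_zero, mul_zero, add_zero, zpow_zero, one_mul, neg_zero] at h1 ⊢
    linear_combination (norm := skip) (q ^ (m : ℤ) * q ^ (m : ℤ) * q ^ (-2 * (m : ℤ))) • h1
    match_scalars
    · ring
    · have e : q ^ (m : ℤ) * q ^ (m : ℤ) * q ^ (-2 * (m : ℤ)) = 1 := by
        rw [← zpow_add₀ hq0, ← zpow_add₀ hq0, ← zpow_zero q]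
        congr 1
        ring
      linear_combination (-betaRatio q s) * e
  · have h2 := qInt_smul_qInt_smul_waveFun_succ_m_p hq0 hq hβ s l p m n
    simp only [n.succ_ne_zero, if_false, Nat.add_sub_cancel]
    linear_combination (norm := skip) (q ^ (1 * (m : ℤ)) * q ^ (1 * (m : ℤ))
      * q ^ (1 * ((n + 1 : ℕ) : ℤ)) * q ^ (-2 * ((m : ℤ) + (n + 1 : ℕ)))) • h1
      + (lam q * q⁻¹ * q ^ (-1 * (l : ℤ)) * q ^ (1 * ((m + 1 : ℕ) : ℤ))
        * q ^ (1 * ((m + 1 : ℕ) : ℤ)) * q ^ (1 * (n : ℤ)) * q ^ (-2 * (((m + 1 : ℕ) : ℤ) + n))) • h2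
    match_scalars
    · ring
    · ring
    · have e1 : q ^ (1 * (m : ℤ)) * q ^ (1 * (m : ℤ)) * q ^ (1 * ((n + 1 : ℕ) : ℤ))
          * q ^ (-2 * ((m : ℤ) + (n + 1 : ℕ))) = q ^ (-((n : ℤ) + 1)) := by
        simp only [← zpow_add₀ hq0]
        congr 1
        push_cast
        ring
      have e2 : q⁻¹ * q ^ (-1 * (l : ℤ)) * q ^ (1 * ((m + 1 : ℕ) : ℤ))
          * q ^ (1 * ((m + 1 : ℕ) : ℤ)) * q ^ (1 * (n : ℤ)) * q ^ (-2 * (((m + 1 : ℕ) : ℤ) + n))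
          * q ^ (l : ℤ) = q ^ (-((n : ℤ) + 1)) := by
        simp only [← zpow_neg_one, ← zpow_add₀ hq0]
        congr 1
        push_cast
        ring
      have e3 : q ^ (-((n : ℤ) + 1)) * q ^ ((n : ℤ) + 1) = 1 := by
        rw [← zpow_add₀ hq0, neg_add_cancel, zpow_zero]
      have e4 := lam_mul_qInt hq0 hq ((n : ℤ) + 1)
      push_cast at e1 e2 ⊢
      linear_combination (-betaRatio q s * q ^ (-((n : ℤ) + 1))) * e1
        - (betaRatio q s * lam q * qInt q ((n : ℤ) + 1)) * e2
        - (betaRatio q s * q ^ (-((n : ℤ) + 1))) * e4 - betaRatio q s * e3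

theorem R₁_th0 (hq0 : q ≠ 0) (hq : ∀ n : ℕ, 0 < n → q ^ n = 1 → q = 1)
    (hβ : ∀ s, betaInv q s ≠ 0) (s : ℕ) : R₁ q (th0 q (s + 1))
      = (betaRatio q s * q⁻¹) • (kk q .p * th0 q s) := by
  rw [th0, th0, th_eq_slice, th_eq_slice]
  simp only [R₁, Module.End.mul_apply, T_vb_slice, T_xp_slice, D_xm_slice, kk_mul_slice,
    ← slice_smul]
  congr
  funext l p m n
  simp only [smul_comm (qInt _ _)]
  rw [qInt_smul_waveFun_succ_m hq0 hq hβ]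
  simp only [smul_smul]
  congr 1
  have e : q⁻¹ = q ^ (1 * (l : ℤ)) * q ^ (1 * (p : ℤ)) * q ^ (-l - p - 1 : ℤ) := by
    simp only [← zpow_neg_one, ← zpow_add₀ hq0]
    congr 1
    ring
  linear_combination (-betaRatio q s) * e

theorem R₂_th0 (hq0 : q ≠ 0) (hq : ∀ n : ℕ, 0 < n → q ^ n = 1 → q = 1)
    (hβ : ∀ s, betaInv q s ≠ 0) (s : ℕ) : R₂ q (th0 q (s + 1))
      = (-betaRatio q s * q ^ (s + 1 : ℤ)) • (kk q .v * th0 q s) := by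
  rw [th0, th0, th_eq_slice, th_eq_slice]
  simp only [R₂, Module.End.mul_apply, LinearMap.add_apply, LinearMap.smul_apply, M_apply,
    T_xp_slice, T_xm_slice, T_vb_slice, D_xm_slice, D_xp_slice, D_vb_slice, x_v_mul_slice,
    kk_mul_slice, ← slice_smul, ← slice_add]
  congr
  funext l p m n
  have h1 := qInt_smul_waveFun_succ_vb hq0 hq hβ s l p m n
  have hs : (-betaRatio q s * q ^ (s + 1 : ℤ)) • (k q .v * waveFun₀ q s l p m n)
      = (-betaRatio q s * q ^ (l + p + m + n + 1 : ℤ)) • (k q .v * waveFun₀ q s l p m n) := by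
    refine smul_mul_waveFun_congr fun h => ?_
    rw [h]
    push_cast
    rfl
  rw [hs]
  rcases n with _ | n
  · simp only [if_true, Nat.cast_zero, add_zero, zpow_zero, one_mul, neg_zero] at h1 ⊢
    linear_combination (norm := skip) (q ^ ((l + 1 : ℕ) : ℤ) * q ^ (m : ℤ) * q ^ (p : ℤ)) • h1
    match_scalars
    · ring
    · have e : q ^ ((l + 1 : ℕ) : ℤ) * q ^ (m : ℤ) * q ^ (p : ℤ) = q ^ (l + p + m + 1 : ℤ) := by
        simp only [← zpow_add₀ hq0]
        congr 1
        push_cast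
        ring
      push_cast at e ⊢
      linear_combination (-betaRatio q s) * e
  · have h2 := qInt_smul_qInt_smul_waveFun_succ_m_p hq0 hq hβ s l p m n
    simp only [n.succ_ne_zero, if_false, Nat.add_sub_cancel]
    linear_combination (norm := skip) (q ^ (1 * ((l + 1 : ℕ) : ℤ)) * q ^ (1 * (m : ℤ))
      * q ^ (1 * (p : ℤ))) • h1
      + (q⁻¹ * lam q * q ^ (1 * ((m + 1 : ℕ) : ℤ)) * q ^ (1 * ((p + 1 : ℕ) : ℤ))) • h2
    match_scalars
    · ring
    · ring
    · have e1 : q ^ (1 * ((l + 1 : ℕ) : ℤ)) * q ^ (1 * (m : ℤ)) * q ^ (1 * (p : ℤ))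
          = q ^ (l + m + p + 1 : ℤ) := by
        simp only [← zpow_add₀ hq0]
        congr 1
        push_cast
        ring
      have e2 : q⁻¹ * q ^ (1 * ((m + 1 : ℕ) : ℤ)) * q ^ (1 * ((p + 1 : ℕ) : ℤ))
          * q ^ (l : ℤ) = q ^ (l + m + p + 1 : ℤ) := by
        simp only [← zpow_neg_one, ← zpow_add₀ hq0]
        congr 1
        push_cast
        ring
      have e3 : q ^ (l + p + m + ((n : ℤ) + 1) + 1)
          = q ^ (l + m + p + 1 : ℤ) * q ^ ((n : ℤ) + 1) := by
        rw [← zpow_add₀ hq0]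
        congr 1
        ring
      have e4 := lam_mul_qInt hq0 hq ((n : ℤ) + 1)
      push_cast at e1 e2 ⊢
      linear_combination (-betaRatio q s * q ^ (-((n : ℤ) + 1))) * e1
        - (betaRatio q s * lam q * qInt q ((n : ℤ) + 1)) * e2
        - (betaRatio q s * q ^ (l + m + p + 1 : ℤ)) * e4 + betaRatio q s * e3

theorem R₃_th0 (hq0 : q ≠ 0) (hq : ∀ n : ℕ, 0 < n → q ^ n = 1 → q = 1)
    (hβ : ∀ s, betaInv q s ≠ 0) (s : ℕ) : R₃ q (th0 q (s + 1))
      = -betaRatio q s • (kk q .vb * th0 q s) := by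
  rw [th0, th0, th_eq_slice, th_eq_slice]
  simp only [R₃, Module.End.mul_apply, T_vb_slice, T_xp_slice, T_xm_slice, D_v_slice, kk_mul_slice,
    ← slice_smul]
  congr
  funext l p m n
  simp only [smul_comm (qInt _ _)]
  rw [qInt_smul_waveFun_succ_v hq0 hq hβ]
  simp only [smul_smul]
  congr 1
  have e : q ^ (-1 * (m : ℤ)) * q ^ (1 * (l : ℤ)) * q ^ (1 * (p : ℤ))
      * q ^ (m - p - l : ℤ) = 1 := by
    simp only [← zpow_add₀ hq0]
    rw [← zpow_zero q]
    congr 1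
    ring
  linear_combination (-betaRatio q s) * e

theorem R₄_th0 (hq0 : q ≠ 0) (hq : ∀ n : ℕ, 0 < n → q ^ n = 1 → q = 1)
    (hβ : ∀ s, betaInv q s ≠ 0) (s : ℕ) : R₄ q (th0 q (s + 1))
      = (betaRatio q s * q ^ (s + 2 : ℤ)) • (kk q .m * th0 q s) := by
  rw [th0, th0, th_eq_slice, th_eq_slice]
  simp only [R₄, Module.End.mul_apply, T_v_slice, T_xp_slice, D_xp_slice, kk_mul_slice,
    ← slice_smul]
  congr
  funext l p m n
  simp only [smul_comm (qInt _ _)]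
  rw [qInt_smul_waveFun_succ_p hq0 hq hβ]
  simp only [smul_smul]
  refine smul_mul_waveFun_congr fun h => ?_
  have e : q ^ (s + 2 : ℤ) = q ^ (1 * (n : ℤ)) * q ^ (1 * ((p + 1 : ℕ) : ℤ))
      * q ^ (m + l + 1 : ℤ) := by
    simp only [← zpow_add₀ hq0]
    congr 1
    push_cast [h]
    ring
  linear_combination (-betaRatio q s) * e

/-! ### Operators that only act on the coordinates -/

/-- The projection to the part of degree `d` in the momenta. -/
def degProj (q : ℂ) (d : ℕ) : Module.End ℂ (Fld q) := diagOp q fun e => if e .t = d then 1 else 0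

/-- The operator is linear over left multiplication by momenta and preserves the degree in the
momenta. -/
structure MomLinear (A : Module.End ℂ (Fld q)) : Prop where
  map_momElt_mul : ∀ c a φ, A (momElt q c a * φ) = momElt q c a * A φ
  map_degProj : ∀ d φ, A (degProj q d φ) = degProj q d (A φ)

namespace MomLinear

variable {A B : Module.End ℂ (Fld q)}

theorem add (hA : MomLinear A) (hB : MomLinear B) : MomLinear (A + B) where
  map_momElt_mul c a φ := by
    rw [LinearMap.add_apply, hA.map_momElt_mul, hB.map_momElt_mul, LinearMap.add_apply, mul_add]
  map_degProj d φ := by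
    rw [LinearMap.add_apply, hA.map_degProj, hB.map_degProj, LinearMap.add_apply, map_add]

theorem smul (hA : MomLinear A) (r : ℂ) : MomLinear (r • A) where
  map_momElt_mul c a φ := by
    rw [LinearMap.smul_apply, hA.map_momElt_mul, LinearMap.smul_apply, mul_smul_comm]
  map_degProj d φ := by
    rw [LinearMap.smul_apply, hA.map_degProj, LinearMap.smul_apply, map_smul]

theorem sub (hA : MomLinear A) (hB : MomLinear B) : MomLinear (A - B) := by
  rw [sub_eq_add_neg, ← neg_one_smul ℂ B]
  exact hA.add (hB.smul _)

theorem mul (hA : MomLinear A) (hB : MomLinear B) : MomLinear (A * B) where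
  map_momElt_mul c a φ := by
    rw [Module.End.mul_apply, hB.map_momElt_mul, hA.map_momElt_mul, Module.End.mul_apply]
  map_degProj d φ := by
    rw [Module.End.mul_apply, hB.map_degProj, hA.map_degProj, Module.End.mul_apply]

theorem map_kk_mul (hA : MomLinear A) (κ : Mom) (φ : Fld q) : A (kk q κ * φ) = kk q κ * A φ :=
  hA.map_momElt_mul _ _ _

theorem map_kk_pow_mul (hA : MomLinear A) (κ : Mom) (n : ℕ) (φ : Fld q) :
    A (kk q κ ^ n * φ) = kk q κ ^ n * A φ := by
  rw [kk_pow]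
  exact hA.map_momElt_mul _ _ _

end MomLinear

theorem momLinear_diagOp {f : (Var →₀ ℕ) → ℂ} (hf : ∀ e c, f (e - Finsupp.single .t c) = f e) :
    MomLinear (diagOp q f) where
  map_momElt_mul c a φ := by
    ext e
    rw [coeff_diagOp, coeff_momElt_mul, coeff_momElt_mul, coeff_diagOp, hf, smul_ite, smul_zero,
      mul_smul_comm]
  map_degProj d φ := by
    ext e
    rw [degProj, coeff_diagOp, coeff_diagOp, coeff_diagOp, coeff_diagOp, smul_comm]

theorem momLinear_T {i : Var} (hi : i ≠ .t) (c : ℤ) : MomLinear (T q i c) :=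
  momLinear_diagOp fun e d => by simp [hi.symm]

theorem momLinear_brN {i : Var} (hi : i ≠ .t) (c e : ℤ) : MomLinear (brN q c e i) :=
  momLinear_diagOp fun e d => by simp [hi.symm]

theorem momLinear_lowerOp {i : Var} (hi : i ≠ .t) : MomLinear (lowerOp q i) where
  map_momElt_mul c a φ := by
    ext e
    rw [coeff_lowerOp, coeff_momElt_mul, coeff_momElt_mul, coeff_lowerOp]
    have h1 : (e + Finsupp.single i 1 : Var →₀ ℕ) Var.t = e .t := by simp [hi]
    have h2 : e + Finsupp.single i 1 - Finsupp.single Var.t c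
        = e - Finsupp.single Var.t c + Finsupp.single i 1 := by
      ext j
      by_cases hj : j = .t
      · subst hj
        simp [hi]
      · simp [Finsupp.single_apply, Ne.symm hj]
    rw [h1, h2]
  map_degProj d φ := by
    ext e
    rw [coeff_lowerOp, degProj, coeff_diagOp, coeff_diagOp, coeff_lowerOp]
    simp [hi]

theorem momLinear_D {i : Var} (hi : i ≠ .t) : MomLinear (D q i) :=
  (momLinear_lowerOp hi).mul (momLinear_brN hi _ _)

theorem momLinear_M {i : Var} (hi : i ≠ .t) : MomLinear (M q i) where
  map_momElt_mul c a φ := by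
    rw [M_apply, M_apply, x, ← mul_assoc, X_mul, mul_assoc]
  map_degProj d φ := by
    ext e
    rw [M_apply, M_apply, coeff_x_mul, degProj, coeff_diagOp, coeff_diagOp, coeff_x_mul, smul_ite,
      smul_zero]
    simp [hi]

theorem momLinear_Iplus (n : ℤ) : MomLinear (Iplus q n) := by
  unfold Iplus
  repeat' with_reducible first
    | decide | apply momLinear_D | apply momLinear_M | apply momLinear_T | apply momLinear_brN
    | apply MomLinear.mul | apply MomLinear.smul | apply MomLinear.add | apply MomLinear.sub

theorem momLinear_Iminus (n : ℤ) : MomLinear (Iminus q n) := by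
  unfold Iminus
  repeat' with_reducible first
    | decide | apply momLinear_D | apply momLinear_M | apply momLinear_T | apply momLinear_brN
    | apply MomLinear.mul | apply MomLinear.smul | apply MomLinear.add | apply MomLinear.sub

theorem momLinear_I13 : MomLinear (I13 q) := by
  unfold I13
  repeat' with_reducible first
    | decide | apply momLinear_D | apply momLinear_M | apply momLinear_T | apply momLinear_brN
    | apply MomLinear.mul | apply MomLinear.smul | apply MomLinear.add

theorem momLinear_P₁ : MomLinear (P₁ q) :=
  (momLinear_D (by decide)).mul (momLinear_T (by decide) _)

theorem momLinear_P₂ : MomLinear (P₂ q) := by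
  unfold P₂
  repeat' with_reducible first
    | decide | apply momLinear_D | apply momLinear_T | apply MomLinear.mul

theorem momLinear_P₃ : MomLinear (P₃ q) := by
  unfold P₃
  repeat' with_reducible first
    | decide | apply momLinear_D | apply momLinear_T | apply MomLinear.mul

theorem momLinear_P₄ : MomLinear (P₄ q) := by
  unfold P₄
  repeat' with_reducible first
    | decide | apply momLinear_D | apply momLinear_M | apply momLinear_T | apply MomLinear.mul
    | apply MomLinear.smul | apply MomLinear.add

theorem momLinear_R₁ : MomLinear (R₁ q) := by
  unfold R₁
  repeat' with_reducible first
    | decide | apply momLinear_D | apply momLinear_T | apply MomLinear.mul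

theorem momLinear_R₂ : MomLinear (R₂ q) := by
  unfold R₂
  repeat' with_reducible first
    | decide | apply momLinear_D | apply momLinear_M | apply momLinear_T | apply MomLinear.mul
    | apply MomLinear.smul | apply MomLinear.add

theorem momLinear_R₃ : MomLinear (R₃ q) := by
  unfold R₃
  repeat' with_reducible first
    | decide | apply momLinear_D | apply momLinear_T | apply MomLinear.mul

theorem momLinear_R₄ : MomLinear (R₄ q) := by
  unfold R₄
  repeat' with_reducible first
    | decide | apply momLinear_D | apply momLinear_T | apply MomLinear.mul

/-! ### Formal sums -/

/-- All terms of the field have degree at least `d` in the momenta. -/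
def DegGE (d : ℕ) (φ : Fld q) : Prop := ∀ e : Var →₀ ℕ, e .t < d → coeff e φ = 0

namespace DegGE

variable {c d : ℕ} {φ ψ : Fld q}

theorem mono (h : DegGE d φ) (hcd : c ≤ d) : DegGE c φ := fun e he => h e (he.trans_le hcd)

theorem zero : DegGE d (0 : Fld q) := fun _ _ => map_zero _

theorem of_nat_zero : DegGE 0 φ := fun _ h => absurd h (Nat.not_lt_zero _)

theorem add (hφ : DegGE d φ) (hψ : DegGE d ψ) : DegGE d (φ + ψ) := fun e he => by
  rw [map_add, hφ e he, hψ e he, add_zero]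

theorem smul (r : ℂ) (hφ : DegGE d φ) : DegGE d (r • φ) := fun e he => by
  rw [coeff_smul', hφ e he, smul_zero]

theorem sum {ι : Type*} {s : Finset ι} {f : ι → Fld q} (h : ∀ i ∈ s, DegGE d (f i)) :
    DegGE d (∑ i ∈ s, f i) := fun e he => by
  rw [map_sum]
  exact Finset.sum_eq_zero fun i hi => h i hi e he

theorem mul (hφ : DegGE c φ) (hψ : DegGE d ψ) : DegGE (c + d) (φ * ψ) := fun e he => by
  classical
  rw [coeff_mul]
  refine Finset.sum_eq_zero fun p hp => ?_
  rw [Finset.HasAntidiagonal.mem_antidiagonal] at hp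
  have h : p.1 .t + p.2 .t = e .t := by rw [← hp]; rfl
  by_cases h1 : p.1 .t < c
  · rw [hφ _ h1, zero_mul]
  · rw [hψ _ (by omega), mul_zero]

theorem momElt (a : MomAlg q) : DegGE d (momElt q d a) := fun e he => by
  classical
  rw [QMaxwell.momElt, coeff_monomial, if_neg]
  rintro rfl
  simp at he

theorem kk_pow (κ : Mom) : DegGE d (kk q κ ^ d) := by
  rw [QMaxwell.kk_pow]
  exact momElt _

theorem slice {a b : ℕ} (f : ℕ → ℕ → ℕ → ℕ → MomAlg q) : DegGE d (slice q d a b f) :=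
  fun e he => by rw [coeff_slice, if_neg (fun h => he.ne h.1)]

end DegGE

theorem degGE_th (Q : ℕ → ℕ → ℕ → ℤ) (s : ℕ) : DegGE s (th q Q s) := by
  rw [th_eq_slice]
  exact DegGE.slice _

/-- The degrees in the momenta of the terms of the family tend to infinity. -/
def DegTendsTop (f : ℕ → ℕ → Fld q) : Prop := ∀ m s, DegGE m (f m s) ∧ DegGE s (f m s)

theorem DegTendsTop.of_add {f : ℕ → ℕ → Fld q} (h : ∀ m s, DegGE (m + s) (f m s)) :
    DegTendsTop f := fun m s =>
  ⟨(h m s).mono (Nat.le_add_right _ _), (h m s).mono (Nat.le_add_left _ _)⟩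

theorem DegTendsTop.support_subset {f : ℕ → ℕ → Fld q} (h : DegTendsTop f) (e : Var →₀ ℕ) :
    {p : ℕ × ℕ | coeff e (f p.1 p.2) ≠ 0}
      ⊆ ↑(Finset.range (e .t + 1) ×ˢ Finset.range (e .t + 1)) := by
  rintro ⟨m, s⟩ hp
  rw [Finset.mem_coe, Finset.mem_product, Finset.mem_range, Finset.mem_range]
  by_contra hc
  refine hp ?_
  by_cases hm : e .t < m
  · exact (h m s).1 e hm
  · exact (h m s).2 e (by simp only at hc; omega)

theorem DegTendsTop.formallySummable {f : ℕ → ℕ → Fld q} (h : DegTendsTop f) :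
    FormallySummable f := fun e => (Finset.finite_toSet _).subset (h.support_subset e)

theorem DegTendsTop.coeff_formalSum {f : ℕ → ℕ → Fld q} (h : DegTendsTop f) (e : Var →₀ ℕ) :
    coeff e (formalSum f) = coeff e
      (∑ p ∈ Finset.range (e .t + 1) ×ˢ Finset.range (e .t + 1), f p.1 p.2) := by
  rw [map_sum]
  exact finsum_eq_sum_of_support_subset _ (h.support_subset e)

theorem DegTendsTop.degProj_formalSum {f : ℕ → ℕ → Fld q} (h : DegTendsTop f) (d : ℕ) :
    degProj q d (formalSum f) = degProj q d
      (∑ p ∈ Finset.range (d + 1) ×ˢ Finset.range (d + 1), f p.1 p.2) := by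
  ext e
  rw [degProj, coeff_diagOp, coeff_diagOp]
  split_ifs with he
  · rw [h.coeff_formalSum, he]
  · rw [zero_smul, zero_smul]

theorem ext_degProj {φ ψ : Fld q} (h : ∀ d, degProj q d φ = degProj q d ψ) : φ = ψ := by
  ext e
  have := congrArg (coeff e) (h (e .t))
  rwa [degProj, coeff_diagOp, coeff_diagOp, if_pos rfl, one_smul, one_smul] at this

theorem DegGE.map {A : Module.End ℂ (Fld q)} (hA : MomLinear A) {d : ℕ} {φ : Fld q}
    (h : DegGE d φ) : DegGE d (A φ) := fun e he => by
  have h0 : degProj q (e .t) φ = 0 := by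
    ext e'
    rw [degProj, coeff_diagOp]
    split_ifs with h'
    · rw [h e' (h' ▸ he), smul_zero, map_zero]
    · rw [zero_smul, map_zero]
  have h1 := congrArg (coeff e) (hA.map_degProj (e .t) φ)
  rw [h0, map_zero, map_zero, degProj, coeff_diagOp, if_pos rfl, one_smul] at h1
  exact h1.symm

theorem DegTendsTop.map {A : Module.End ℂ (Fld q)} (hA : MomLinear A) {f : ℕ → ℕ → Fld q}
    (h : DegTendsTop f) : DegTendsTop fun m s => A (f m s) :=
  fun m s => ⟨(h m s).1.map hA, (h m s).2.map hA⟩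

theorem DegTendsTop.add {f g : ℕ → ℕ → Fld q} (hf : DegTendsTop f) (hg : DegTendsTop g) :
    DegTendsTop fun m s => f m s + g m s :=
  fun m s => ⟨(hf m s).1.add (hg m s).1, (hf m s).2.add (hg m s).2⟩

theorem MomLinear.map_formalSum {A : Module.End ℂ (Fld q)} (hA : MomLinear A)
    {f : ℕ → ℕ → Fld q} (h : DegTendsTop f) :
    A (formalSum f) = formalSum fun m s => A (f m s) := by
  refine ext_degProj fun d => ?_
  rw [← hA.map_degProj, h.degProj_formalSum, hA.map_degProj, (h.map hA).degProj_formalSum, map_sum]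

theorem DegTendsTop.formalSum_add {f g : ℕ → ℕ → Fld q} (hf : DegTendsTop f)
    (hg : DegTendsTop g) : formalSum (fun m s => f m s + g m s) = formalSum f + formalSum g := by
  refine ext_degProj fun d => ?_
  rw [map_add, hf.degProj_formalSum, hg.degProj_formalSum, (hf.add hg).degProj_formalSum,
    Finset.sum_add_distrib, map_add]

theorem formalSum_zero : formalSum (fun _ _ => (0 : Fld q)) = 0 := by
  ext e
  exact (finsum_congr fun _ => map_zero _).trans finsum_zero

/-! ### Fields without `z` and `z̄` -/

/-- The field is a slice of degree zero in `z` and `z̄`. -/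
def IsZFree (φ : Fld q) : Prop := ∃ d f, φ = slice q d 0 0 f

theorem isZFree_th (Q : ℕ → ℕ → ℕ → ℤ) (s : ℕ) : IsZFree (th q Q s) := ⟨_, _, th_eq_slice Q s⟩

namespace IsZFree

variable {φ : Fld q}

theorem momElt_mul (hφ : IsZFree φ) (c : ℕ) (a : MomAlg q) : IsZFree (momElt q c a * φ) := by
  obtain ⟨d, f, rfl⟩ := hφ
  exact ⟨_, _, momElt_mul_slice _ _⟩

theorem kk_mul (hφ : IsZFree φ) (κ : Mom) : IsZFree (kk q κ * φ) := hφ.momElt_mul _ _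

theorem Iplus_eq (hφ : IsZFree φ) : Iplus q 0 φ
    = (1 / 2 * q * qInt q 2) • (P₁ q φ + x q .zb * P₂ q φ) := by
  obtain ⟨d, f, rfl⟩ := hφ
  exact Iplus_slice

theorem Iplus_z_mul (hφ : IsZFree φ) : Iplus q 0 (x q .z * φ)
    = (1 / 2 * q * qInt q 1) • (x q .z * P₁ q φ + x q .z * (x q .zb * P₂ q φ))
      - (1 / 2 * q ^ 3 * qInt q 1) • (P₃ q φ + x q .zb * P₄ q φ) := by
  obtain ⟨d, f, rfl⟩ := hφ
  exact Iplus_z_mul_slice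

theorem Iplus_z_mul_z_mul (hφ : IsZFree φ) : Iplus q 0 (x q .z * (x q .z * φ))
    = - (1 / 2 * q ^ 3 * qInt q 2) • (x q .z * P₃ q φ + x q .z * (x q .zb * P₄ q φ)) := by
  obtain ⟨d, f, rfl⟩ := hφ
  exact Iplus_z_mul_z_mul_slice

theorem Iminus_eq (hφ : IsZFree φ) : Iminus q 0 φ
    = (1 / 2 * qInt q 2) • (R₂ q φ + x q .z * R₄ q φ) := by
  obtain ⟨d, f, rfl⟩ := hφ
  exact Iminus_slice

theorem Iminus_zb_mul (hφ : IsZFree φ) : Iminus q 0 (x q .zb * φ)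
    = (1 / 2 * q * qInt q 1) • (x q .zb * R₂ q φ + x q .z * (x q .zb * R₄ q φ))
      - (1 / 2 * (q ^ 2)⁻¹ * q * qInt q 1) • (R₁ q φ + x q .z * R₃ q φ) := by
  obtain ⟨d, f, rfl⟩ := hφ
  exact Iminus_zb_mul_slice

theorem Iminus_zb_mul_zb_mul (hφ : IsZFree φ) : Iminus q 0 (x q .zb * (x q .zb * φ))
    = - (1 / 2 * (q ^ 2)⁻¹ * q ^ 2 * qInt q 2) •
        (x q .zb * R₁ q φ + x q .z * (x q .zb * R₃ q φ)) := by
  obtain ⟨d, f, rfl⟩ := hφ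
  exact Iminus_zb_mul_zb_mul_slice

theorem I13_zb_mul_z_mul (hφ : IsZFree φ) : I13 q (x q .zb * x q .z * φ)
    = (q ^ 2 * qInt q 1 ^ 2) • R₁ q φ := by
  obtain ⟨d, f, rfl⟩ := hφ
  exact I13_zb_mul_z_mul_slice

theorem I13_z_mul (hq0 : q ≠ 0) (hφ : IsZFree φ) : I13 q (x q .z * φ)
    = -(q ^ 2 * qInt q 1 ^ 2) • R₂ q φ := by
  obtain ⟨d, f, rfl⟩ := hφ
  exact I13_z_mul_slice hq0

theorem I13_zb_mul (hφ : IsZFree φ) : I13 q (x q .zb * φ) = -(q * qInt q 1 ^ 2) • R₃ q φ := by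
  obtain ⟨d, f, rfl⟩ := hφ
  exact I13_zb_mul_slice

theorem I13_eq (hφ : IsZFree φ) : I13 q φ = (q * qInt q 1 ^ 2) • R₄ q φ := by
  obtain ⟨d, f, rfl⟩ := hφ
  exact I13_slice

end IsZFree

theorem qInt_one (hq0 : q ≠ 0) (hq : ∀ n : ℕ, 0 < n → q ^ n = 1 → q = 1) : qInt q 1 = 1 := by
  unfold qInt
  split_ifs with h1
  · simp
  · rw [zpow_one, zpow_neg_one, div_self (lam_ne_zero hq0 hq h1)]

theorem qInt_two (hq0 : q ≠ 0) (hq : ∀ n : ℕ, 0 < n → q ^ n = 1 → q = 1) :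
    qInt q 2 = q + q⁻¹ := by
  unfold qInt
  split_ifs with h1
  · rw [h1]
    norm_num
  · rw [div_eq_iff (lam_ne_zero hq0 hq h1), zpow_neg]
    norm_cast
    ring

/-! ### Normal ordering of products acting on a field -/

@[simp]
theorem kk_p_mul_v_mul (φ : Fld q) :
    kk q .p * (kk q .v * φ) = q • (kk q .v * (kk q .p * φ)) := by
  rw [← mul_assoc, kk_p_mul_v, smul_mul_assoc, mul_assoc]

@[simp]
theorem kk_m_mul_v_mul (φ : Fld q) :
    kk q .m * (kk q .v * φ) = q⁻¹ • (kk q .v * (kk q .m * φ)) := by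
  rw [← mul_assoc, kk_m_mul_v, smul_mul_assoc, mul_assoc]

@[simp]
theorem kk_p_mul_vb_mul (φ : Fld q) :
    kk q .p * (kk q .vb * φ) = q • (kk q .vb * (kk q .p * φ)) := by
  rw [← mul_assoc, kk_p_mul_vb, smul_mul_assoc, mul_assoc]

@[simp]
theorem kk_m_mul_vb_mul (φ : Fld q) :
    kk q .m * (kk q .vb * φ) = q⁻¹ • (kk q .vb * (kk q .m * φ)) := by
  rw [← mul_assoc, kk_m_mul_vb, smul_mul_assoc, mul_assoc]

@[simp]
theorem kk_vb_mul_v_mul (φ : Fld q) :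
    kk q .vb * (kk q .v * φ) = kk q .v * (kk q .vb * φ) := by
  rw [← mul_assoc, kk_vb_mul_v, mul_assoc]

@[simp]
theorem kk_m_mul_p_mul (φ : Fld q) :
    kk q .m * (kk q .p * φ) = q⁻¹ • (kk q .v * (kk q .vb * φ)) := by
  rw [← mul_assoc, kk_m_mul_p, smul_mul_assoc, mul_assoc]

@[simp]
theorem kk_p_mul_m_mul (φ : Fld q) :
    kk q .p * (kk q .m * φ) = q • (kk q .v * (kk q .vb * φ)) := by
  rw [← mul_assoc, kk_p_mul_m, smul_mul_assoc, mul_assoc]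

@[simp]
theorem kk_mul_x_mul (κ : Mom) (i : Var) (φ : Fld q) :
    kk q κ * (x q i * φ) = x q i * (kk q κ * φ) := by
  rw [← mul_assoc, x, ← X_mul, mul_assoc]

@[simp]
theorem zb_mul_z_mul (φ : Fld q) : x q .zb * (x q .z * φ) = x q .z * (x q .zb * φ) :=
  by rw [← mul_assoc, x, x, X_mul, mul_assoc]

@[simp]
theorem P₁_kk_mul (κ : Mom) (φ : Fld q) : P₁ q (kk q κ * φ) = kk q κ * P₁ q φ :=
  momLinear_P₁.map_kk_mul κ φ

@[simp]
theorem P₂_kk_mul (κ : Mom) (φ : Fld q) : P₂ q (kk q κ * φ) = kk q κ * P₂ q φ :=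
  momLinear_P₂.map_kk_mul κ φ

@[simp]
theorem P₃_kk_mul (κ : Mom) (φ : Fld q) : P₃ q (kk q κ * φ) = kk q κ * P₃ q φ :=
  momLinear_P₃.map_kk_mul κ φ

@[simp]
theorem P₄_kk_mul (κ : Mom) (φ : Fld q) : P₄ q (kk q κ * φ) = kk q κ * P₄ q φ :=
  momLinear_P₄.map_kk_mul κ φ

@[simp]
theorem R₁_kk_mul (κ : Mom) (φ : Fld q) : R₁ q (kk q κ * φ) = kk q κ * R₁ q φ :=
  momLinear_R₁.map_kk_mul κ φ

@[simp]
theorem R₂_kk_mul (κ : Mom) (φ : Fld q) : R₂ q (kk q κ * φ) = kk q κ * R₂ q φ :=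
  momLinear_R₂.map_kk_mul κ φ

@[simp]
theorem R₃_kk_mul (κ : Mom) (φ : Fld q) : R₃ q (kk q κ * φ) = kk q κ * R₃ q φ :=
  momLinear_R₃.map_kk_mul κ φ

@[simp]
theorem R₄_kk_mul (κ : Mom) (φ : Fld q) : R₄ q (kk q κ * φ) = kk q κ * R₄ q φ :=
  momLinear_R₄.map_kk_mul κ φ

/-- `z̄ z J_+ + z J_v + z̄ J_v̄ + J_-` for `J_+ = -q^{s+1} k_- ψ`, `J_v = k_v̄ ψ`,
`J_v̄ = q^s k_v ψ`, `J_- = -q^{-1} k_+ ψ`. -/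
def currentCore (q : ℂ) (s : ℕ) (ψ : Fld q) : Fld q :=
  -(q ^ (s + 1)) • (x q .z * (x q .zb * (kk q .m * ψ))) + x q .z * (kk q .vb * ψ)
    + q ^ s • (x q .zb * (kk q .v * ψ)) - q⁻¹ • (kk q .p * ψ)

/-- The relations between a field and plane wave components that determine `I^+`. -/
structure PlusRel (c₁ c₂ : ℂ) (φ ψ₁ ψ₂ : Fld q) : Prop where
  zfree : IsZFree φ
  P₁_eq : P₁ q φ = -c₁ • (kk q .vb * ψ₁)
  P₃_eq : P₃ q φ = (c₁ * q⁻¹) • (kk q .p * ψ₁)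
  P₂_eq : P₂ q φ = (c₂ * q) • (kk q .m * ψ₂)
  P₄_eq : P₄ q φ = -c₂ • (kk q .v * ψ₂)

/-- The relations between a field and a plane wave component that determine `I^-` and `I_13`. -/
structure MinusRel (ρ : ℂ) (s : ℕ) (φ ψ : Fld q) : Prop where
  zfree : IsZFree φ
  R₁_eq : R₁ q φ = (ρ * q⁻¹) • (kk q .p * ψ)
  R₂_eq : R₂ q φ = (-ρ * q ^ s) • (kk q .v * ψ)
  R₃_eq : R₃ q φ = -ρ • (kk q .vb * ψ)
  R₄_eq : R₄ q φ = (ρ * q ^ (s + 1)) • (kk q .m * ψ)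

variable {c₁ c₂ : ℂ} {φ ψ₁ ψ₂ ψ : Fld q} {s : ℕ} {ρ : ℂ}

theorem PlusRel.Iplus_v_v (hq0 : q ≠ 0) (hq : ∀ n : ℕ, 0 < n → q ^ n = 1 → q = 1)
    (h : PlusRel c₁ c₂ φ ψ₁ ψ₂) :
    Iplus q 0 ((kk q .v - (x q .z * kk q .m)) * ((kk q .v - q • (x q .z * kk q .m)) * φ)) = 0 := by
  simp only [sub_mul, mul_sub, smul_mul_assoc, mul_smul_comm, mul_assoc, kk_mul_x_mul, map_sub,
    map_smul]
  rw [((h.zfree.kk_mul .v).kk_mul .v).Iplus_eq, ((h.zfree.kk_mul .m).kk_mul .v).Iplus_z_mul,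
    ((h.zfree.kk_mul .v).kk_mul .m).Iplus_z_mul,
    ((h.zfree.kk_mul .m).kk_mul .m).Iplus_z_mul_z_mul]
  simp [h.P₁_eq, h.P₂_eq, h.P₃_eq, h.P₄_eq, qInt_one hq0 hq, qInt_two hq0 hq,
    mul_add]
  match_scalars <;> field_simp <;> ring

theorem PlusRel.Iplus_p_v (hq0 : q ≠ 0) (hq : ∀ n : ℕ, 0 < n → q ^ n = 1 → q = 1)
    (h : PlusRel c₁ c₂ φ ψ₁ ψ₂) :
    Iplus q 0 ((kk q .p - (x q .z * kk q .vb)) * ((kk q .v - q • (x q .z * kk q .m)) * φ)) = 0 := by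
  simp only [sub_mul, mul_sub, smul_mul_assoc, mul_smul_comm, mul_assoc, kk_mul_x_mul, map_sub,
    map_smul]
  rw [((h.zfree.kk_mul .v).kk_mul .p).Iplus_eq, ((h.zfree.kk_mul .m).kk_mul .p).Iplus_z_mul,
    ((h.zfree.kk_mul .v).kk_mul .vb).Iplus_z_mul,
    ((h.zfree.kk_mul .m).kk_mul .vb).Iplus_z_mul_z_mul]
  simp [h.P₁_eq, h.P₂_eq, h.P₃_eq, h.P₄_eq, qInt_one hq0 hq, qInt_two hq0 hq,
    mul_add]
  match_scalars <;> field_simp <;> ring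

theorem PlusRel.Iplus_p_p (hq0 : q ≠ 0) (hq : ∀ n : ℕ, 0 < n → q ^ n = 1 → q = 1)
    (h : PlusRel c₁ c₂ φ ψ₁ ψ₂) :
    Iplus q 0 ((kk q .p - (x q .z * kk q .vb))
      * ((kk q .p - q • (x q .z * kk q .vb)) * φ)) = 0 := by
  simp only [sub_mul, mul_sub, smul_mul_assoc, mul_smul_comm, mul_assoc, kk_mul_x_mul, map_sub,
    map_smul]
  rw [((h.zfree.kk_mul .p).kk_mul .p).Iplus_eq, ((h.zfree.kk_mul .vb).kk_mul .p).Iplus_z_mul,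
    ((h.zfree.kk_mul .p).kk_mul .vb).Iplus_z_mul,
    ((h.zfree.kk_mul .vb).kk_mul .vb).Iplus_z_mul_z_mul]
  simp [h.P₁_eq, h.P₂_eq, h.P₃_eq, h.P₄_eq, qInt_one hq0 hq, qInt_two hq0 hq,
    mul_add]
  match_scalars <;> field_simp <;> ring

theorem MinusRel.Iminus_vb_vb (hq0 : q ≠ 0) (hq : ∀ n : ℕ, 0 < n → q ^ n = 1 → q = 1)
    (h : MinusRel ρ s φ ψ) :
    Iminus q 0 ((kk q .vb - q ^ (s + 5) • (x q .zb * kk q .m))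
      * ((kk q .vb - q ^ (s + 2) • (x q .zb * kk q .m)) * φ)) = 0 := by
  simp only [sub_mul, mul_sub, smul_mul_assoc, mul_smul_comm, mul_assoc, kk_mul_x_mul, map_sub,
    map_smul]
  rw [((h.zfree.kk_mul .vb).kk_mul .vb).Iminus_eq, ((h.zfree.kk_mul .m).kk_mul .vb).Iminus_zb_mul,
    ((h.zfree.kk_mul .vb).kk_mul .m).Iminus_zb_mul,
    ((h.zfree.kk_mul .m).kk_mul .m).Iminus_zb_mul_zb_mul]
  simp [h.R₁_eq, h.R₂_eq, h.R₃_eq, h.R₄_eq, qInt_one hq0 hq, qInt_two hq0 hq,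
    mul_add]
  match_scalars <;> field_simp <;> ring

theorem MinusRel.Iminus_vb_p (hq0 : q ≠ 0) (hq : ∀ n : ℕ, 0 < n → q ^ n = 1 → q = 1)
    (h : MinusRel ρ s φ ψ) :
    Iminus q 0 ((kk q .vb - q ^ (s + 5) • (x q .zb * kk q .m))
      * ((kk q .p - q ^ (s + 2) • (x q .zb * kk q .v)) * φ)) = 0 := by
  simp only [sub_mul, mul_sub, smul_mul_assoc, mul_smul_comm, mul_assoc, kk_mul_x_mul, map_sub,
    map_smul]
  rw [((h.zfree.kk_mul .p).kk_mul .vb).Iminus_eq, ((h.zfree.kk_mul .v).kk_mul .vb).Iminus_zb_mul,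
    ((h.zfree.kk_mul .p).kk_mul .m).Iminus_zb_mul,
    ((h.zfree.kk_mul .v).kk_mul .m).Iminus_zb_mul_zb_mul]
  simp [h.R₁_eq, h.R₂_eq, h.R₃_eq, h.R₄_eq, qInt_one hq0 hq, qInt_two hq0 hq,
    mul_add]
  match_scalars <;> field_simp <;> ring

theorem MinusRel.Iminus_p_p (hq0 : q ≠ 0) (hq : ∀ n : ℕ, 0 < n → q ^ n = 1 → q = 1)
    (h : MinusRel ρ s φ ψ) :
    Iminus q 0 ((kk q .p - q ^ (s + 5) • (x q .zb * kk q .v))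
      * ((kk q .p - q ^ (s + 2) • (x q .zb * kk q .v)) * φ)) = 0 := by
  simp only [sub_mul, mul_sub, smul_mul_assoc, mul_smul_comm, mul_assoc, kk_mul_x_mul, map_sub,
    map_smul]
  rw [((h.zfree.kk_mul .p).kk_mul .p).Iminus_eq, ((h.zfree.kk_mul .v).kk_mul .p).Iminus_zb_mul,
    ((h.zfree.kk_mul .p).kk_mul .v).Iminus_zb_mul,
    ((h.zfree.kk_mul .v).kk_mul .v).Iminus_zb_mul_zb_mul]
  simp [h.R₁_eq, h.R₂_eq, h.R₃_eq, h.R₄_eq, qInt_one hq0 hq, qInt_two hq0 hq,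
    mul_add]
  match_scalars <;> field_simp <;> ring

theorem PlusRel.Iplus_v (hq0 : q ≠ 0) (hq : ∀ n : ℕ, 0 < n → q ^ n = 1 → q = 1)
    (h : PlusRel (ρ * (q ^ s)⁻¹) ρ φ ψ ψ) :
    Iplus q 0 ((kk q .v - q • (x q .z * kk q .m)) * φ)
      = (ρ / 2 * q ^ 2 * (q ^ s)⁻¹) • (kk q .m * currentCore q s ψ) := by
  simp only [sub_mul, smul_mul_assoc, mul_assoc, map_sub,
    map_smul]
  rw [(h.zfree.kk_mul .v).Iplus_eq, (h.zfree.kk_mul .m).Iplus_z_mul]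
  simp [h.P₁_eq, h.P₂_eq, h.P₃_eq, h.P₄_eq, qInt_one hq0 hq, qInt_two hq0 hq,
    mul_add, mul_sub, currentCore]
  match_scalars <;> field_simp <;> ring

theorem PlusRel.Iplus_z_v (hq0 : q ≠ 0) (hq : ∀ n : ℕ, 0 < n → q ^ n = 1 → q = 1)
    (h : PlusRel (ρ * (q ^ s)⁻¹) ρ φ ψ ψ) :
    Iplus q 0 (x q .z * ((kk q .v - q • (x q .z * kk q .m)) * φ))
      = (ρ / 2 * q ^ 3 * (q ^ s)⁻¹) • (kk q .v * currentCore q s ψ) := by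
  simp only [sub_mul, mul_sub, smul_mul_assoc, mul_smul_comm, mul_assoc, map_sub,
    map_smul]
  rw [(h.zfree.kk_mul .v).Iplus_z_mul, (h.zfree.kk_mul .m).Iplus_z_mul_z_mul]
  simp [h.P₁_eq, h.P₂_eq, h.P₃_eq, h.P₄_eq, qInt_one hq0 hq, qInt_two hq0 hq,
    mul_add, mul_sub, currentCore]
  match_scalars <;> field_simp <;> ring

theorem PlusRel.Iplus_p (hq0 : q ≠ 0) (hq : ∀ n : ℕ, 0 < n → q ^ n = 1 → q = 1)
    (h : PlusRel (ρ * (q ^ s)⁻¹) ρ φ ψ ψ) :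
    Iplus q 0 ((kk q .p - q • (x q .z * kk q .vb)) * φ)
      = (ρ / 2 * q ^ 2 * (q ^ s)⁻¹) • (kk q .vb * currentCore q s ψ) := by
  simp only [sub_mul, smul_mul_assoc, mul_assoc, map_sub,
    map_smul]
  rw [(h.zfree.kk_mul .p).Iplus_eq, (h.zfree.kk_mul .vb).Iplus_z_mul]
  simp [h.P₁_eq, h.P₂_eq, h.P₃_eq, h.P₄_eq, qInt_one hq0 hq, qInt_two hq0 hq,
    mul_add, mul_sub, currentCore]
  match_scalars <;> field_simp <;> ring

theorem PlusRel.Iplus_z_p (hq0 : q ≠ 0) (hq : ∀ n : ℕ, 0 < n → q ^ n = 1 → q = 1)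
    (h : PlusRel (ρ * (q ^ s)⁻¹) ρ φ ψ ψ) :
    Iplus q 0 (x q .z * ((kk q .p - q • (x q .z * kk q .vb)) * φ))
      = (ρ / 2 * q ^ 3 * (q ^ s)⁻¹) • (kk q .p * currentCore q s ψ) := by
  simp only [sub_mul, mul_sub, smul_mul_assoc, mul_smul_comm, mul_assoc, map_sub,
    map_smul]
  rw [(h.zfree.kk_mul .p).Iplus_z_mul, (h.zfree.kk_mul .vb).Iplus_z_mul_z_mul]
  simp [h.P₁_eq, h.P₂_eq, h.P₃_eq, h.P₄_eq, qInt_one hq0 hq, qInt_two hq0 hq,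
    mul_add, mul_sub, currentCore]
  match_scalars <;> field_simp <;> ring

theorem MinusRel.Iminus_vb (hq0 : q ≠ 0) (hq : ∀ n : ℕ, 0 < n → q ^ n = 1 → q = 1)
    (h : MinusRel ρ s φ ψ) :
    Iminus q 0 ((kk q .vb - q ^ (s + 2) • (x q .zb * kk q .m)) * φ)
      = (ρ / 2 * q ^ (s + 3)) • (kk q .m * currentCore q s ψ) := by
  simp only [sub_mul, smul_mul_assoc, mul_assoc, map_sub,
    map_smul]
  rw [(h.zfree.kk_mul .vb).Iminus_eq, (h.zfree.kk_mul .m).Iminus_zb_mul]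
  simp [h.R₁_eq, h.R₂_eq, h.R₃_eq, h.R₄_eq, qInt_one hq0 hq, qInt_two hq0 hq,
    mul_add, mul_sub, currentCore]
  match_scalars <;> field_simp <;> ring

theorem MinusRel.Iminus_zb_vb (hq0 : q ≠ 0) (hq : ∀ n : ℕ, 0 < n → q ^ n = 1 → q = 1)
    (h : MinusRel ρ s φ ψ) :
    Iminus q 0 (x q .zb * ((kk q .vb - q ^ (s + 2) • (x q .zb * kk q .m)) * φ))
      = (ρ / 2 * q⁻¹) • (kk q .vb * currentCore q s ψ) := by
  simp only [sub_mul, mul_sub, smul_mul_assoc, mul_smul_comm, mul_assoc, map_sub,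
    map_smul]
  rw [(h.zfree.kk_mul .vb).Iminus_zb_mul, (h.zfree.kk_mul .m).Iminus_zb_mul_zb_mul]
  simp [h.R₁_eq, h.R₂_eq, h.R₃_eq, h.R₄_eq, qInt_one hq0 hq, qInt_two hq0 hq,
    mul_add, mul_sub, currentCore]
  match_scalars <;> field_simp <;> ring

theorem MinusRel.Iminus_p (hq0 : q ≠ 0) (hq : ∀ n : ℕ, 0 < n → q ^ n = 1 → q = 1)
    (h : MinusRel ρ s φ ψ) :
    Iminus q 0 ((kk q .p - q ^ (s + 2) • (x q .zb * kk q .v)) * φ)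
      = (ρ / 2 * q ^ (s + 3)) • (kk q .v * currentCore q s ψ) := by
  simp only [sub_mul, smul_mul_assoc, mul_assoc, map_sub,
    map_smul]
  rw [(h.zfree.kk_mul .p).Iminus_eq, (h.zfree.kk_mul .v).Iminus_zb_mul]
  simp [h.R₁_eq, h.R₂_eq, h.R₃_eq, h.R₄_eq, qInt_one hq0 hq, qInt_two hq0 hq,
    mul_add, mul_sub, currentCore]
  match_scalars <;> field_simp <;> ring

theorem MinusRel.Iminus_zb_p (hq0 : q ≠ 0) (hq : ∀ n : ℕ, 0 < n → q ^ n = 1 → q = 1)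
    (h : MinusRel ρ s φ ψ) :
    Iminus q 0 (x q .zb * ((kk q .p - q ^ (s + 2) • (x q .zb * kk q .v)) * φ))
      = (ρ / 2 * q⁻¹) • (kk q .p * currentCore q s ψ) := by
  simp only [sub_mul, mul_sub, smul_mul_assoc, mul_smul_comm, mul_assoc, map_sub,
    map_smul]
  rw [(h.zfree.kk_mul .p).Iminus_zb_mul, (h.zfree.kk_mul .v).Iminus_zb_mul_zb_mul]
  simp [h.R₁_eq, h.R₂_eq, h.R₃_eq, h.R₄_eq, qInt_one hq0 hq, qInt_two hq0 hq,
    mul_add, mul_sub, currentCore]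
  match_scalars <;> field_simp <;> ring

/-! ### The plane wave components satisfy the relations -/

theorem D_T_self (hq0 : q ≠ 0) (i : Var) (c : ℤ) (φ : Fld q) :
    D q i (T q i c φ) = q ^ c • T q i c (D q i φ) := by
  ext e
  rw [coeff_D, coeff_smul', T, coeff_diagOp, coeff_diagOp, coeff_D, smul_smul, smul_smul,
    smul_smul]
  congr 1
  have h : q ^ (c * ((e + Finsupp.single i 1 : Var →₀ ℕ) i : ℤ)) = q ^ c * q ^ (c * (e i : ℤ)) := by
    rw [← zpow_add₀ hq0]
    congr 1
    simp
    ring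
  rw [h]
  ring

theorem D_T_of_ne {i j : Var} (h : i ≠ j) (c : ℤ) (φ : Fld q) :
    D q i (T q j c φ) = T q j c (D q i φ) := by
  ext e
  rw [coeff_D, T, coeff_diagOp, coeff_diagOp, coeff_D, smul_comm]
  simp [h]

theorem x_mul_T_self (hq0 : q ≠ 0) (i : Var) (c : ℤ) (φ : Fld q) :
    x q i * T q i c φ = q ^ (-c) • T q i c (x q i * φ) := by
  ext e
  rw [coeff_x_mul, coeff_smul', T, coeff_diagOp, coeff_diagOp, coeff_x_mul]
  split_ifs with he
  · rw [smul_zero, smul_zero]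
  · rw [smul_smul, ← zpow_add₀ hq0]
    congr 2
    have : (((e - Finsupp.single i 1 : Var →₀ ℕ) i : ℕ) : ℤ) = e i - 1 := by
      simp
      omega
    rw [this]
    ring

theorem x_mul_T_of_ne {i j : Var} (h : i ≠ j) (c : ℤ) (φ : Fld q) :
    x q i * T q j c φ = T q j c (x q i * φ) := by
  ext e
  rw [coeff_x_mul, T, coeff_diagOp, coeff_diagOp, coeff_x_mul, smul_ite, smul_zero]
  simp [h]

/-- The operator `T_-^2 T_v^2`, which turns `h̃'_s` into `h̃_s`. -/
def twist (q : ℂ) : Module.End ℂ (Fld q) := T q .xm 2 * T q .v 2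

theorem momLinear_twist : MomLinear (twist q) :=
  (momLinear_T (by decide) _).mul (momLinear_T (by decide) _)

theorem twist_thA (hq0 : q ≠ 0) (s : ℕ) : twist q (thA q s) = th0 q s := by
  rw [thA, th0, th_eq_slice, th_eq_slice, twist, Module.End.mul_apply, T_v_slice, T_xm_slice]
  congr
  funext l p m n
  rw [waveFun_eq_smul, smul_smul, smul_smul, ← zpow_add₀ hq0, ← zpow_add₀ hq0,
    show 2 * (m : ℤ) + 2 * (n : ℤ) + -2 * ((m : ℤ) + n) = 0 by ring]
  simp

theorem P₁_twist (hq0 : q ≠ 0) (φ : Fld q) : P₁ q (twist q φ) = q ^ 2 • twist q (P₁ q φ) := by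
  simp only [P₁, twist, Module.End.mul_apply, T_comm _ .xm 1 2, T_comm _ .v 1 2, D_T_self hq0,
    D_T_of_ne (show Var.v ≠ .xm by decide), map_smul]
  norm_cast

theorem P₃_twist (hq0 : q ≠ 0) (φ : Fld q) : P₃ q (twist q φ) = q ^ 2 • twist q (P₃ q φ) := by
  simp only [P₃, twist, Module.End.mul_apply, T_comm _ .xm 1 2, T_comm _ .v 1 2, D_T_self hq0,
    D_T_of_ne (show Var.xm ≠ .v by decide), map_smul]
  norm_cast

theorem P₂_twist (φ : Fld q) : P₂ q (twist q φ) = twist q (P₂ q φ) := by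
  simp only [P₂, twist, Module.End.mul_apply, T_comm _ .xm 1 2, T_comm _ .v 1 2,
    T_comm _ .xm (-1) 2, T_comm _ .v (-1) 2, D_T_of_ne (show Var.xp ≠ .v by decide),
    D_T_of_ne (show Var.xp ≠ .xm by decide)]

theorem P₄_twist (hq0 : q ≠ 0) (φ : Fld q) : P₄ q (twist q φ) = twist q (P₄ q φ) := by
  simp only [P₄, twist, Module.End.mul_apply, T_comm _ .xm 1 2, T_comm _ .v 1 2,
    T_comm _ .xm (-1) 2, T_comm _ .v (-1) 2, LinearMap.add_apply, LinearMap.smul_apply, map_add,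
    map_smul, M_apply, D_T_self hq0 .xm, smul_smul,
    D_T_of_ne (show Var.xp ≠ .v by decide), D_T_of_ne (show Var.xp ≠ .xm by decide),
    D_T_of_ne (show Var.vb ≠ .v by decide), D_T_of_ne (show Var.vb ≠ .xm by decide),
    D_T_of_ne (show Var.xm ≠ .v by decide), x_mul_T_of_ne (show Var.v ≠ .xm by decide),
    x_mul_T_self hq0]
  congr 2
  rw [mul_assoc, ← zpow_add₀ hq0]
  simp

theorem PlusRel.twist (hq0 : q ≠ 0) {c₁ c₂ : ℂ} {φ ψ₁ ψ₂ : Fld q} (h : PlusRel c₁ c₂ φ ψ₁ ψ₂)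
    (hz : IsZFree (twist q φ)) :
    PlusRel (c₁ * q ^ 2) c₂ (twist q φ) (twist q ψ₁) (twist q ψ₂) where
  zfree := hz
  P₁_eq := by
    rw [P₁_twist hq0, h.P₁_eq, map_smul, momLinear_twist.map_kk_mul, smul_smul]
    congr 1
    ring
  P₃_eq := by
    rw [P₃_twist hq0, h.P₃_eq, map_smul, momLinear_twist.map_kk_mul, smul_smul]
    congr 1
    ring
  P₂_eq := by rw [P₂_twist, h.P₂_eq, map_smul, momLinear_twist.map_kk_mul]
  P₄_eq := by rw [P₄_twist hq0, h.P₄_eq, map_smul, momLinear_twist.map_kk_mul]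

/-- The ratio `β̃^s / β̃^{s-1}`, and zero for `s = 0`. -/
def prevRatio (q : ℂ) : ℕ → ℂ
  | 0 => 0
  | s + 1 => betaRatio q s

theorem plusRel_thA (hq0 : q ≠ 0) (hq : ∀ n : ℕ, 0 < n → q ^ n = 1 → q = 1)
    (hβ : ∀ s, betaInv q s ≠ 0) (s : ℕ) :
    PlusRel (prevRatio q s * (q ^ s)⁻¹) (prevRatio q s) (thA q s) (thPrev q s) (thPrev q s) := by
  refine ⟨isZFree_th _ _, ?_, ?_, ?_, ?_⟩ <;> rcases s with _ | s
  · simp [thA, th_eq_slice, P₁, T_v_slice, D_v_slice, waveFun, slice_zero, thPrev, prevRatio]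
  · rw [P₁_thA hq0 hq hβ, thPrev, prevRatio, neg_mul,
      show (-s - 1 : ℤ) = -((s + 1 : ℕ) : ℤ) by push_cast; ring, zpow_neg, zpow_natCast]
  · simp [thA, th_eq_slice, P₃, T_v_slice, T_xm_slice, D_xm_slice, waveFun, slice_zero, thPrev,
      prevRatio]
  · rw [P₃_thA hq0 hq hβ, thPrev, prevRatio,
      show (-s - 2 : ℤ) = -((s + 1 : ℕ) : ℤ) + -1 by push_cast; ring, zpow_add₀ hq0, zpow_neg,
      zpow_natCast, zpow_neg_one, mul_assoc]
  · simp [thA, th_eq_slice, P₂, T_v_slice, T_xm_slice, T_vb_slice, D_xp_slice, waveFun, slice_zero,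
      thPrev, prevRatio]
  · exact P₂_thA hq0 hq hβ s
  · simp [thA, th_eq_slice, P₄, T_v_slice, T_xm_slice, T_vb_slice, D_xp_slice,
      D_vb_slice, waveFun, slice_zero, thPrev, prevRatio, M_apply]
  · exact P₄_thA hq0 hq hβ s

theorem plusRel_th0 (hq0 : q ≠ 0) (hq : ∀ n : ℕ, 0 < n → q ^ n = 1 → q = 1)
    (hβ : ∀ s, betaInv q s ≠ 0) (s : ℕ) : ∃ c₁ c₂ ψ₁ ψ₂, PlusRel c₁ c₂ (th0 q s) ψ₁ ψ₂ := by
  have h := (plusRel_thA hq0 hq hβ s).twist hq0 (by rw [twist_thA hq0]; exact isZFree_th _ _)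
  rw [twist_thA hq0] at h
  exact ⟨_, _, _, _, h⟩

theorem minusRel_th0 (hq0 : q ≠ 0) (hq : ∀ n : ℕ, 0 < n → q ^ n = 1 → q = 1)
    (hβ : ∀ s, betaInv q s ≠ 0) (s : ℕ) :
    MinusRel (prevRatio q s) s (th0 q s) (thPrev q s) := by
  refine ⟨isZFree_th _ _, ?_, ?_, ?_, ?_⟩ <;> rcases s with _ | s
  · simp [th0, th_eq_slice, R₁, T_vb_slice, T_xp_slice, D_xm_slice, waveFun, slice_zero, thPrev,
      prevRatio]
  · exact R₁_th0 hq0 hq hβ s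
  · simp [th0, th_eq_slice, R₂, T_vb_slice, T_xm_slice, T_xp_slice, D_xp_slice,
      D_vb_slice, waveFun, slice_zero, thPrev, prevRatio, M_apply]
  · exact_mod_cast R₂_th0 hq0 hq hβ s
  · simp [th0, th_eq_slice, R₃, T_vb_slice, T_xm_slice, T_xp_slice, D_v_slice, waveFun, slice_zero,
      thPrev, prevRatio]
  · exact R₃_th0 hq0 hq hβ s
  · simp [th0, th_eq_slice, R₄, T_v_slice, T_xp_slice, D_xp_slice, waveFun, slice_zero,
      thPrev, prevRatio]
  · exact_mod_cast R₄_th0 hq0 hq hβ s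

theorem thPrev_succ (s : ℕ) : thPrev q (s + 1) = th0 q s := rfl

theorem dt_mul_prevRatio_smul_currentCore (hβ : ∀ s, betaInv q s ≠ 0) (d₀ : ℂ) (s : ℕ) :
    (dt q d₀ s * prevRatio q s) • currentCore q s (thPrev q s)
      = currentCore q s (thPrev q s) := by
  rcases s with _ | s
  · simp [thPrev, currentCore]
  · have h : dt q d₀ (s + 1) * prevRatio q (s + 1) = 1 := by
      have h1 : beta q s ≠ 0 := inv_ne_zero (hβ s)
      have h2 : beta q (s + 1) ≠ 0 := inv_ne_zero (hβ (s + 1))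
      rw [dt, prevRatio, betaRatio]
      field_simp
    rw [h, one_smul]

/-- The `(m,s)`-term of the current. -/
def totalTerm (q : ℂ) (C : ℕ → ℕ → Mom → MomAlg q) (m s : ℕ) : Fld q :=
  x q .zb * x q .z * currentTerm q C .p m s + x q .z * currentTerm q C .v m s
    + x q .zb * currentTerm q C .vb m s + currentTerm q C .m m s

/-- `∑_κ γ_κ k_κ^{m+1} φ`. -/
def momSum (q : ℂ) (γ : Mom → ℂ) (m : ℕ) (φ : Fld q) : Fld q :=
  γ .v • (kk q .v ^ m * (kk q .v * φ)) + γ .m • (kk q .m ^ m * (kk q .m * φ))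
    + γ .p • (kk q .p ^ m * (kk q .p * φ)) + γ .vb • (kk q .vb ^ m * (kk q .vb * φ))

theorem momElt_mul_kk_mul (c : ℕ) (a : MomAlg q) (κ : Mom) (φ : Fld q) :
    momElt q (c + 1) (a * k q κ) * φ = momElt q c a * (kk q κ * φ) := by
  rw [← mul_assoc, kk, momElt_mul]

theorem momElt_Kt_mul (γ : ℕ → Mom → ℂ) (m s : ℕ) (φ : Fld q) :
    momElt q (m + 1) (Kt q γ m s) * φ = momSum q (γ s) m φ := by
  simp only [Kt, momElt_add, momElt_smul, pow_succ, add_mul, smul_mul_assoc, momElt_mul_kk_mul,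
    ← kk_pow, momSum]

theorem momElt_mul_x_mul (c : ℕ) (a : MomAlg q) (i : Var) (φ : Fld q) :
    momElt q c a * (x q i * φ) = x q i * (momElt q c a * φ) := by
  rw [← mul_assoc, x, ← X_mul, mul_assoc]

theorem totalTerm_Jt (γ : ℕ → Mom → ℂ) (m s : ℕ) : totalTerm q (Jt q γ) m s
    = (qFact q s)⁻¹ • momSum q (γ s) m (currentCore q s (thPrev q s)) := by
  rw [← momElt_Kt_mul]
  simp only [totalTerm, currentTerm, Jt, currentCore, momElt_neg, momElt_smul, neg_mul,
    smul_mul_assoc, momElt_mul_kk_mul, mul_add, mul_sub, mul_smul_comm, momElt_mul_x_mul,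
    mul_assoc, zb_mul_z_mul, mul_neg]
  module

theorem Iplus_waveTerm_FtPlus (hq0 : q ≠ 0) (hq : ∀ n : ℕ, 0 < n → q ^ n = 1 → q = 1)
    (hβ : ∀ s, betaInv q s ≠ 0) (d₀ : ℂ) (γ : ℕ → Mom → ℂ) (m s : ℕ) :
    Iplus q 0 (waveTerm q (FtPlus q d₀ γ) (thA q) m s) = totalTerm q (Jt q γ) m s := by
  have h := plusRel_thA hq0 hq hβ s
  have hF : FtPlus q d₀ γ m s * thA q s = (2 * dt q d₀ s * q ^ ((s : ℤ) - 2)) •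
      (γ s .m • (kk q .m ^ m * ((kk q .v - q • (x q .z * kk q .m)) * thA q s))
      + (q⁻¹ * γ s .v) • (kk q .v ^ m * (x q .z * ((kk q .v - q • (x q .z * kk q .m)) * thA q s)))
      + γ s .vb • (kk q .vb ^ m * ((kk q .p - q • (x q .z * kk q .vb)) * thA q s))
      + (q⁻¹ * γ s .p) •
        (kk q .p ^ m * (x q .z * ((kk q .p - q • (x q .z * kk q .vb)) * thA q s)))) := by
    simp only [FtPlus, smul_mul_assoc, add_mul, mul_assoc, kk_pow, momElt_mul_x_mul, add_assoc]
  rw [totalTerm_Jt, waveTerm, map_smul, hF, ← dt_mul_prevRatio_smul_currentCore hβ d₀]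
  simp only [map_smul, map_add, (momLinear_Iplus 0).map_kk_pow_mul, h.Iplus_v hq0 hq,
    h.Iplus_z_v hq0 hq, h.Iplus_p hq0 hq, h.Iplus_z_p hq0 hq, momSum, mul_smul_comm,
    zpow_sub₀ hq0, zpow_natCast]
  norm_cast
  match_scalars <;> field_simp

theorem Iminus_waveTerm_FtMinus (hq0 : q ≠ 0) (hq : ∀ n : ℕ, 0 < n → q ^ n = 1 → q = 1)
    (hβ : ∀ s, betaInv q s ≠ 0) (d₀ : ℂ) (γ : ℕ → Mom → ℂ) (m s : ℕ) :
    Iminus q 0 (waveTerm q (FtMinus q d₀ γ) (th0 q) m s) = totalTerm q (Jt q γ) m s := by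
  have h := minusRel_th0 hq0 hq hβ s
  have hF : FtMinus q d₀ γ m s * th0 q s = (2 * dt q d₀ s) •
      ((q ^ (-(s : ℤ) - 3) * γ s .m) •
        (kk q .m ^ m * ((kk q .vb - q ^ (s + 2) • (x q .zb * kk q .m)) * th0 q s))
      + (q * γ s .vb) •
        (kk q .vb ^ m * (x q .zb * ((kk q .vb - q ^ (s + 2) • (x q .zb * kk q .m)) * th0 q s)))
      + (q ^ (-(s : ℤ) - 3) * γ s .v) •
        (kk q .v ^ m * ((kk q .p - q ^ (s + 2) • (x q .zb * kk q .v)) * th0 q s))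
      + (q * γ s .p) •
        (kk q .p ^ m *
          (x q .zb * ((kk q .p - q ^ (s + 2) • (x q .zb * kk q .v)) * th0 q s)))) := by
    simp only [FtMinus, smul_mul_assoc, add_mul, mul_assoc, kk_pow, momElt_mul_x_mul, add_assoc]
  rw [totalTerm_Jt, waveTerm, map_smul, hF, ← dt_mul_prevRatio_smul_currentCore hβ d₀]
  simp only [map_smul, map_add, (momLinear_Iminus 0).map_kk_pow_mul, h.Iminus_vb hq0 hq,
    h.Iminus_zb_vb hq0 hq, h.Iminus_p hq0 hq, h.Iminus_zb_p hq0 hq, momSum, mul_smul_comm,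
    zpow_sub₀ hq0, zpow_neg, zpow_natCast]
  norm_cast
  match_scalars <;> field_simp <;> ring

theorem Iplus_waveTerm_FhPlus (hq0 : q ≠ 0) (hq : ∀ n : ℕ, 0 < n → q ^ n = 1 → q = 1)
    (hβ : ∀ s, betaInv q s ≠ 0) (p₁ : ℕ → ℕ → ℕ → ℕ → ℂ) (p₂ : ℕ → ℕ → ℕ → ℂ)
    (p₃ : ℕ → ℕ → ℕ → ℕ → ℂ) (m s : ℕ) :
    Iplus q 0 (waveTerm q (FhPlus q p₁ p₂ p₃) (th0 q) m s) = 0 := by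
  obtain ⟨c₁, c₂, ψ₁, ψ₂, h⟩ := plusRel_th0 hq0 hq hβ s
  simp only [waveTerm, FhPlus, Finset.sum_mul, add_mul, smul_mul_assoc, mul_assoc, map_smul,
    map_sum, map_add, (momLinear_Iplus 0).map_kk_pow_mul, h.Iplus_v_v hq0 hq, h.Iplus_p_v hq0 hq,
    h.Iplus_p_p hq0 hq, mul_zero, smul_zero, add_zero, Finset.sum_const_zero]

theorem Iminus_waveTerm_FhMinus (hq0 : q ≠ 0) (hq : ∀ n : ℕ, 0 < n → q ^ n = 1 → q = 1)
    (hβ : ∀ s, betaInv q s ≠ 0) (r₁ : ℕ → ℕ → ℕ → ℕ → ℂ) (r₂ : ℕ → ℕ → ℕ → ℂ)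
    (r₃ : ℕ → ℕ → ℕ → ℕ → ℂ) (m s : ℕ) :
    Iminus q 0 (waveTerm q (FhMinus q r₁ r₂ r₃) (th0 q) m s) = 0 := by
  have h := minusRel_th0 hq0 hq hβ s
  simp only [waveTerm, FhMinus, Finset.sum_mul, add_mul, smul_mul_assoc, mul_assoc, map_smul,
    map_sum, map_add, (momLinear_Iminus 0).map_kk_pow_mul, h.Iminus_vb_vb hq0 hq,
    h.Iminus_vb_p hq0 hq, h.Iminus_p_p hq0 hq, mul_zero, smul_zero, add_zero,
    Finset.sum_const_zero]

theorem I13_totalTerm (hq0 : q ≠ 0) (hq : ∀ n : ℕ, 0 < n → q ^ n = 1 → q = 1)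
    (hβ : ∀ s, betaInv q s ≠ 0) (C : ℕ → ℕ → Mom → MomAlg q) (m s : ℕ)
    (hC : MomConservation q s (C m s)) : I13 q (totalTerm q C m s) = 0 := by
  rcases s with _ | s
  · simp [totalTerm, currentTerm, thPrev]
  have h := minusRel_th0 hq0 hq hβ s
  have hz (a : MomAlg q) : IsZFree (momElt q (m + 2) a * th0 q s) := h.zfree.momElt_mul _ _
  have h0 : momElt q (m + 2 + 1) (C m (s + 1) .p * k q .p
      + q ^ (s + 1) • (C m (s + 1) .v * k q .v) + C m (s + 1) .vb * k q .vb
      + q ^ (s + 1) • (C m (s + 1) .m * k q .m)) * thPrev q s = 0 := by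
    rw [hC, momElt, map_zero, zero_mul]
  simp only [momElt_add, momElt_smul, add_mul, smul_mul_assoc, momElt_mul_kk_mul] at h0
  simp only [totalTerm, currentTerm, thPrev_succ, map_add, mul_smul_comm, map_smul,
    (hz _).I13_zb_mul_z_mul, (hz _).I13_z_mul hq0, (hz _).I13_zb_mul, (hz _).I13_eq,
    momLinear_R₁.map_momElt_mul, momLinear_R₂.map_momElt_mul, momLinear_R₃.map_momElt_mul,
    momLinear_R₄.map_momElt_mul, h.R₁_eq, h.R₂_eq, h.R₃_eq, h.R₄_eq, qInt_one hq0 hq]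
  linear_combination (norm := skip) ((qFact q (s + 1))⁻¹ * prevRatio q s * q) • h0
  match_scalars <;> field_simp <;> ring

/-! ### Momentum relations of the current -/

theorem Jt_splitting (hq0 : q ≠ 0) (γ : ℕ → Mom → ℂ) (m s : ℕ) :
    Jt q γ m s .p * k q .p + q ^ s • (Jt q γ m s .v * k q .v) = 0 ∧
      Jt q γ m s .vb * k q .vb + q ^ s • (Jt q γ m s .m * k q .m) = 0 ∧
      Jt q γ m s .p * k q .p + Jt q γ m s .vb * k q .vb = 0 ∧
      Jt q γ m s .v * k q .v + Jt q γ m s .m * k q .m = 0 := by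
  simp only [Jt, neg_mul, smul_mul_assoc, mul_assoc, k_m_mul_p, k_p_mul_m, k_vb_mul_v,
    mul_smul_comm]
  refine ⟨?_, ?_, ?_, ?_⟩ <;> match_scalars <;> field_simp <;> ring

theorem Jt_relations (hq0 : q ≠ 0) (γ : ℕ → Mom → ℂ) (m s : ℕ) :
    Jt q γ m s .p * k q .vb + q ^ s • (Jt q γ m s .v * k q .m) = 0 ∧
      Jt q γ m s .vb * k q .p + q ^ s • (Jt q γ m s .m * k q .v) = 0 ∧
      Jt q γ m s .p * k q .v + Jt q γ m s .vb * k q .m = 0 ∧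
      Jt q γ m s .v * k q .p + Jt q γ m s .m * k q .vb = 0 := by
  simp only [Jt, neg_mul, smul_mul_assoc, mul_assoc, k_p_mul_v, k_m_mul_v, k_p_mul_vb, k_m_mul_vb,
    mul_smul_comm]
  refine ⟨?_, ?_, ?_, ?_⟩ <;> match_scalars <;> field_simp <;> ring

theorem momConservation_Jt (hq0 : q ≠ 0) (γ : ℕ → Mom → ℂ) (m s : ℕ) :
    MomConservation q s (Jt q γ m s) := by
  obtain ⟨h1, h2, -, -⟩ := Jt_splitting hq0 γ m s
  rw [MomConservation, h1, zero_add, h2]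

/-! ### Summability -/

theorem degTendsTop_currentTerm (C : ℕ → ℕ → Mom → MomAlg q) (κ : Mom) :
    DegTendsTop (currentTerm q C κ) := by
  refine .of_add fun m s => DegGE.smul _ ?_
  have h : DegGE (s - 1) (thPrev q s) := by
    rcases s with _ | s
    · exact DegGE.zero
    · exact degGE_th (fun _ _ _ => 0) s
  exact ((DegGE.momElt _).mul h).mono (by omega)

theorem degTendsTop_waveTerm {G : ℕ → ℕ → Fld q} (hG : ∀ m s, DegGE m (G m s))
    (Q : ℕ → ℕ → ℕ → ℤ) : DegTendsTop (waveTerm q G (th q Q)) :=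
  .of_add fun m s => ((hG m s).mul (degGE_th Q s)).smul _

theorem degGE_FtPlus (d₀ : ℂ) (γ : ℕ → Mom → ℂ) (m s : ℕ) : DegGE m (FtPlus q d₀ γ m s) := by
  have hx (κ : Mom) : DegGE m (x q .z * kk q κ ^ m) :=
    (DegGE.of_nat_zero.mul (DegGE.kk_pow κ)).mono (zero_add m).ge
  have hk (κ : Mom) : DegGE m (kk q κ ^ m) := DegGE.kk_pow κ
  exact .smul _ <| .add (.mul (d := 0) (.add (.smul _ (hk _)) (.smul _ (hx _))) .of_nat_zero)
    (.mul (d := 0) (.add (.smul _ (hk _)) (.smul _ (hx _))) .of_nat_zero)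

theorem degGE_FtMinus (d₀ : ℂ) (γ : ℕ → Mom → ℂ) (m s : ℕ) : DegGE m (FtMinus q d₀ γ m s) := by
  have hx (κ : Mom) : DegGE m (x q .zb * kk q κ ^ m) :=
    (DegGE.of_nat_zero.mul (DegGE.kk_pow κ)).mono (zero_add m).ge
  have hk (κ : Mom) : DegGE m (kk q κ ^ m) := DegGE.kk_pow κ
  exact .smul _ <| .add (.mul (d := 0) (.add (.smul _ (hk _)) (.smul _ (hx _))) .of_nat_zero)
    (.mul (d := 0) (.add (.smul _ (hk _)) (.smul _ (hx _))) .of_nat_zero)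

theorem degGE_three_factors {m i j : ℕ} (κ μ ν : Mom) (φ ψ : Fld q) :
    DegGE m (kk q κ ^ i * kk q μ ^ (m - i - j) * kk q ν ^ j * φ * ψ) :=
  (((((DegGE.kk_pow κ).mul (DegGE.kk_pow μ)).mul (DegGE.kk_pow ν)).mul
    .of_nat_zero).mul .of_nat_zero).mono (by omega)

theorem degGE_two_factors {m i : ℕ} (κ μ : Mom) (φ ψ : Fld q) :
    DegGE m (kk q κ ^ i * kk q μ ^ (m - i) * φ * ψ) :=
  ((((DegGE.kk_pow κ).mul (DegGE.kk_pow μ)).mul .of_nat_zero).mul .of_nat_zero).mono (by omega)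

theorem degGE_FhPlus (p₁ : ℕ → ℕ → ℕ → ℕ → ℂ) (p₂ : ℕ → ℕ → ℕ → ℂ) (p₃ : ℕ → ℕ → ℕ → ℕ → ℂ)
    (m s : ℕ) : DegGE m (FhPlus q p₁ p₂ p₃ m s) :=
  .sum fun _ _ => .add (.add (.sum fun _ _ => .smul _ (degGE_three_factors _ _ _ _ _))
    (.smul _ (degGE_two_factors _ _ _ _))) (.sum fun _ _ => .smul _ (degGE_three_factors _ _ _ _ _))

theorem degGE_FhMinus (r₁ : ℕ → ℕ → ℕ → ℕ → ℂ) (r₂ : ℕ → ℕ → ℕ → ℂ) (r₃ : ℕ → ℕ → ℕ → ℕ → ℂ)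
    (m s : ℕ) : DegGE m (FhMinus q r₁ r₂ r₃ m s) :=
  .sum fun _ _ => .add (.add (.sum fun _ _ => .smul _ (degGE_three_factors _ _ _ _ _))
    (.smul _ (degGE_two_factors _ _ _ _))) (.sum fun _ _ => .smul _ (degGE_three_factors _ _ _ _ _))

theorem degTendsTop_totalTerm (C : ℕ → ℕ → Mom → MomAlg q) : DegTendsTop (totalTerm q C) := by
  have hz : MomLinear (M q .z) := momLinear_M (by decide)
  have hzb : MomLinear (M q .zb) := momLinear_M (by decide)
  have h := degTendsTop_currentTerm C
  have := ((((h .p).map (hzb.mul hz)).add ((h .v).map hz)).add ((h .vb).map hzb)).add (h .m)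
  simp only [Module.End.mul_apply, M_apply, ← mul_assoc] at this
  exact this

theorem current_eq_formalSum (C : ℕ → ℕ → Mom → MomAlg q) :
    current q C = formalSum (totalTerm q C) := by
  have hz : MomLinear (M q .z) := momLinear_M (by decide)
  have hzb : MomLinear (M q .zb) := momLinear_M (by decide)
  have h := degTendsTop_currentTerm C
  have e := (((((h .p).map (hzb.mul hz)).add ((h .v).map hz)).add
    ((h .vb).map hzb)).formalSum_add (h .m))
  rw [(((h .p).map (hzb.mul hz)).add ((h .v).map hz)).formalSum_add ((h .vb).map hzb),
    ((h .p).map (hzb.mul hz)).formalSum_add ((h .v).map hz), ← (hzb.mul hz).map_formalSum (h .p),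
    ← hz.map_formalSum (h .v), ← hzb.map_formalSum (h .vb)] at e
  simp only [Module.End.mul_apply, M_apply, ← mul_assoc] at e
  exact e.symm

theorem map_formalSum_eq {A : Module.End ℂ (Fld q)} (hA : MomLinear A) {f g : ℕ → ℕ → Fld q}
    (hf : DegTendsTop f) (h : ∀ m s, A (f m s) = g m s) : A (formalSum f) = formalSum g := by
  rw [hA.map_formalSum hf]
  simp only [h]

theorem I13_current (hq0 : q ≠ 0) (hq : ∀ n : ℕ, 0 < n → q ^ n = 1 → q = 1)
    (hβ : ∀ s, betaInv q s ≠ 0) (C : ℕ → ℕ → Mom → MomAlg q)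
    (hC : ∀ m s, MomConservation q s (C m s)) : I13 q (current q C) = 0 := by
  rw [current_eq_formalSum, map_formalSum_eq momLinear_I13 (degTendsTop_totalTerm C)
    fun m s => I13_totalTerm hq0 hq hβ C m s (hC m s), formalSum_zero]

end QMaxwell

end

theorem mainTheorem4 (q : ℂ) (hq0 : q ≠ 0)
    (hq : ∀ n : ℕ, 0 < n → q ^ n = 1 → q = 1)
    (hβ : ∀ s : ℕ, betaInv q s ≠ 0)
    (d₀ : ℂ) (γ : ℕ → Mom → ℂ)
    (p₁ : ℕ → ℕ → ℕ → ℕ → ℂ) (p₂ : ℕ → ℕ → ℕ → ℂ) (p₃ : ℕ → ℕ → ℕ → ℕ → ℂ)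
    (r₁ : ℕ → ℕ → ℕ → ℕ → ℂ) (r₂ : ℕ → ℕ → ℕ → ℂ) (r₃ : ℕ → ℕ → ℕ → ℕ → ℂ) :
    -- all the series make sense
    ((∀ κ, FormallySummable (currentTerm q (Jt q γ) κ)) ∧
      FormallySummable (waveTerm q (FtPlus q d₀ γ) (thA q)) ∧
      FormallySummable (waveTerm q (FtMinus q d₀ γ) (th0 q)) ∧
      FormallySummable (waveTerm q (FhPlus q p₁ p₂ p₃) (th0 q)) ∧
      FormallySummable (waveTerm q (FhMinus q r₁ r₂ r₃) (th0 q))) ∧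
    -- the homogeneous q-Maxwell equations
    (Iplus q 0 (wave q (FhPlus q p₁ p₂ p₃) (th0 q)) = 0 ∧
      Iminus q 0 (wave q (FhMinus q r₁ r₂ r₃) (th0 q)) = 0) ∧
    -- the full q-Maxwell equations
    (Iplus q 0 (wave q (FtPlus q d₀ γ) (thA q) + wave q (FhPlus q p₁ p₂ p₃) (th0 q))
        = current q (Jt q γ) ∧
      Iminus q 0 (wave q (FtMinus q d₀ γ) (th0 q) + wave q (FhMinus q r₁ r₂ r₃) (th0 q))
        = current q (Jt q γ)) ∧
    -- q-current conservation, and its form in momentum space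
    I13 q (current q (Jt q γ)) = 0 ∧
    (∀ C : ℕ → ℕ → Mom → MomAlg q, (∀ m s, MomConservation q s (C m s)) →
      I13 q (current q C) = 0) ∧
    (∀ m s : ℕ, MomConservation q s (Jt q γ m s)) ∧
    -- the splittings
    (∀ m s : ℕ,
      Jt q γ m s .p * k q .p + q ^ s • (Jt q γ m s .v * k q .v) = 0 ∧
      Jt q γ m s .vb * k q .vb + q ^ s • (Jt q γ m s .m * k q .m) = 0 ∧
      Jt q γ m s .p * k q .p + Jt q γ m s .vb * k q .vb = 0 ∧
      Jt q γ m s .v * k q .v + Jt q γ m s .m * k q .m = 0) ∧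
    -- the additional momentum relations
    (∀ m s : ℕ,
      Jt q γ m s .p * k q .vb + q ^ s • (Jt q γ m s .v * k q .m) = 0 ∧
      Jt q γ m s .vb * k q .p + q ^ s • (Jt q γ m s .m * k q .v) = 0 ∧
      Jt q γ m s .p * k q .v + Jt q γ m s .vb * k q .m = 0 ∧
      Jt q γ m s .v * k q .p + Jt q γ m s .m * k q .vb = 0) := by
  have hFp := degTendsTop_waveTerm (degGE_FtPlus (q := q) d₀ γ) fun _ a _ => -2 * (a : ℤ)
  have hFm := degTendsTop_waveTerm (degGE_FtMinus (q := q) d₀ γ) fun _ _ _ => 0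
  have hhp := degTendsTop_waveTerm (degGE_FhPlus (q := q) p₁ p₂ p₃) fun _ _ _ => 0
  have hhm := degTendsTop_waveTerm (degGE_FhMinus (q := q) r₁ r₂ r₃) fun _ _ _ => 0
  have hp : Iplus q 0 (wave q (FhPlus q p₁ p₂ p₃) (th0 q)) = 0 :=
    (map_formalSum_eq (momLinear_Iplus 0) hhp
      (Iplus_waveTerm_FhPlus hq0 hq hβ p₁ p₂ p₃)).trans formalSum_zero
  have hm : Iminus q 0 (wave q (FhMinus q r₁ r₂ r₃) (th0 q)) = 0 :=
    (map_formalSum_eq (momLinear_Iminus 0) hhm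
      (Iminus_waveTerm_FhMinus hq0 hq hβ r₁ r₂ r₃)).trans formalSum_zero
  refine ⟨⟨fun κ => (degTendsTop_currentTerm _ κ).formallySummable, hFp.formallySummable,
    hFm.formallySummable, hhp.formallySummable, hhm.formallySummable⟩, ⟨hp, hm⟩, ⟨?_, ?_⟩,
    I13_current hq0 hq hβ _ (momConservation_Jt hq0 γ), I13_current hq0 hq hβ,
    momConservation_Jt hq0 γ, Jt_splitting hq0 γ, Jt_relations hq0 γ⟩
  · rw [map_add, hp, add_zero, current_eq_formalSum]
    exact map_formalSum_eq (momLinear_Iplus 0) hFp (Iplus_waveTerm_FtPlus hq0 hq hβ d₀ γ)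
  · rw [map_add, hm, add_zero, current_eq_formalSum]
    exact map_formalSum_eq (momLinear_Iminus 0) hFm (Iminus_waveTerm_FtMinus hq0 hq hβ d₀ γ)
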